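/- **Setting.** Let $T>0$. Let $X$ be the set of sequences $a=(a_1,a_2,\dots)$ of bounded measurable functions $a_i:[0,T]\to\mathbb C$ with $\sup_{x\in[0,T],\,i\ge1}|a_i(x)|^{1/i}<\infty$. For $a,b\in X$ let $a*b$ be given by $(a*b)_i(x)=2b_i(2x)$ for $x\le T/2$ and $(a*b)_i(x)=2a_i(2x-T)$ for $x>T/2$, and let $(a^{-1})_i(x)=-a_i(T-x)$. For $i_1,\dots,i_k\ge 1$ let $$I_{i_1,\dots,i_k}(a)=\int\cdots\int_{0\le s_1\le\cdots\le s_k\le T}a_{i_k}(s_k)\cdots a_{i_1}(s_1)\,ds_k\cdots ds_1$$ (equal to $1$ for $k=0$). Write $a\sim b$ if $I_{i_1,\dots,i_k}(a*b^{-1})=0$ for all $k\ge1$ and all $i_1,\dots,i_k$. The quotient $G(X)=X/\!\sim$ is a group under the product induced by $*$. It is a topological group in the weakest topology in which all iterated integrals are continuous. Let $G$ be the topological group of formal power series $$f=I+\sum_{n\ge1}\Big(\sum_{i_1+\dots+i_k=n}c_{i_1,\dots,i_k}X_{i_1}\cdots X_{i_k}\Big)t^n,\qquad c_{i_1,\dots,i_k}\in\mathbb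 C,$$ in free noncommuting variables $X_1,X_2,\dots$, with the topology of coefficientwise convergence. The map $E(a)=F_a(T)$, where $F_a'=\big(\sum_i a_it^iX_i\big)F_a$ and $F_a(0)=I$, i.e. $$E(a)=I+\sum_{k\ge1}\sum_{i_1,\dots,i_k}I_{i_1,\dots,i_k}(a)\,X_{i_k}\cdots X_{i_1}\,t^{i_1+\dots+i_k},$$ identifies $G(X)$ with a subgroup of $G$. The completion $G_f(X)$ of $G(X)$ is identified with the closure of $G(X)$ in $G$. Let $X_*\subset X$ be the set of $a$ with $I_s(a)=0$ for all $s\ge1$, let $G(X_*)\subset G(X)$ be its image (the subgroup of closed paths), and let $G_f(X_*)$ be the closure of $G(X_*)$ in $G_f(X)$ (the subgroup of formal closed paths). Put $\widetilde a_i(x)=\int_0^xa_i(s)\,ds$. A moment of order $k\ge1$ on $X$ is a function $$m(a)=\int\cdots\int_{0\le s_1\le\cdots\le s_k\le T}p_k(a;s_k)\cdots p_1(a;s_1)\,ds_k\cdots ds_1,$$ where each $p_j(a;x)$ is of the form $\widetilde a_{i_1}(x)^{n_1}\cdots\widetilde a_{i_r}(x)^{n_r}\,a_{i_{r+1}}(x)$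 with $r\ge 0$, $i_1,\dots,i_{r+1}\ge1$ and $n_1,\dots,n_r\ge0$. A moment of order $k$ on $G_f(X)$ is the continuous extension to $G_f(X)$ of the function on $G(X)$ induced by a moment of order $k$ on $X$. For a topological group $K$ let $K_1=[K,K]$ and $K_n=[K,K_{n-1}]$ for $n\ge2$, and let $\overline{K}_n$ be the closure of $K_n$ in $K$; these are the terms of the topological lower central series of $K$. **Theorem.** Let $n\ge1$. 1. An element $g\in G_f(X_*)$ belongs to $\overline{G_f(X_*)}_n$ if and only if all moments of order $\le n$ vanish at $g$. 2. $\overline{G(X_*)}_n=\overline{G_f(X_*)}_n\cap G(X_*)$. -/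

import Mathlib

open scoped Topology Interval

namespace FormalPaths

/-! ## The group of noncommutative formal power series with constant term one -/

/-- The group `G` of series
`f = I + ∑_{n ≥ 1} (∑_{i₁ + ⋯ + iₖ = n} c_{i₁,…,iₖ} X_{i₁} ⋯ X_{iₖ}) tⁿ`
in free noncommuting variables `X₁, X₂, …`. The exponent of `t` is the weight `i₁ + ⋯ + iₖ` of the
monomial, so `f` is the same thing as the family of its coefficients: `coeff [i₁, …, iₖ]` is the
coefficient of `X_{i₁} ⋯ X_{iₖ}`, and the constant term is `1`. -/
@[ext]
structure SeriesGroup where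
  /-- The coefficient at a word. -/
  coeff : List ℕ+ → ℂ
  coeff_nil : coeff [] = 1

/-- Coefficients of the product of two series:
`(f g)_w = ∑_{w = u v} f_u g_v`, the sum being over all ways to cut the word `w` in two. -/
noncomputable def conv (f g : List ℕ+ → ℂ) (w : List ℕ+) : ℂ :=
  ∑ k ∈ Finset.range (w.length + 1), f (w.take k) * g (w.drop k)

theorem conv_nil (f g : List ℕ+ → ℂ) : conv f g [] = f [] * g [] := by
  simp [conv]

theorem conv_cons (f g : List ℕ+ → ℂ) (i : ℕ+) (w : List ℕ+) :
    conv f g (i :: w) = conv (fun u => f (i :: u)) g w + f [] * g (i :: w) := by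
  simp only [conv, List.length_cons]
  rw [Finset.sum_range_succ']
  simp

theorem conv_add_left (f f' g : List ℕ+ → ℂ) (w : List ℕ+) :
    conv (fun u => f u + f' u) g w = conv f g w + conv f' g w := by
  simp [conv, add_mul, Finset.sum_add_distrib]

theorem conv_mul_left (c : ℂ) (f g : List ℕ+ → ℂ) (w : List ℕ+) :
    conv (fun u => c * f u) g w = c * conv f g w := by
  simp [conv, Finset.mul_sum, mul_assoc]

theorem conv_assoc (f g h : List ℕ+ → ℂ) (w : List ℕ+) :
    conv (conv f g) h w = conv f (conv g h) w := by
  induction w generalizing f g with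
  | nil => simp [conv_nil, mul_assoc]
  | cons i w ih =>
    rw [conv_cons, conv_cons]
    simp only [conv_cons, conv_nil]
    rw [conv_add_left, conv_mul_left, ih]
    ring

/-- Coefficients of the inverse of a series with constant term one. -/
noncomputable def invCoeff (f : List ℕ+ → ℂ) : List ℕ+ → ℂ
  | [] => 1
  | i :: w => -∑ k : Fin (w.length + 1), f (i :: w.take k) * invCoeff f (w.drop k)
termination_by w => w.length
decreasing_by simp

theorem invCoeff_nil (f : List ℕ+ → ℂ) : invCoeff f [] = 1 := by
  rw [invCoeff]

theorem invCoeff_cons (f : List ℕ+ → ℂ) (i : ℕ+) (w : List ℕ+) :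
    invCoeff f (i :: w) = -conv (fun u => f (i :: u)) (invCoeff f) w := by
  rw [invCoeff, conv, Finset.sum_range]

namespace SeriesGroup

noncomputable instance : Mul SeriesGroup :=
  ⟨fun f g => ⟨conv f.coeff g.coeff, by simp [conv_nil, f.coeff_nil, g.coeff_nil]⟩⟩

/-- The unit is the series `I`. -/
noncomputable instance : One SeriesGroup :=
  ⟨⟨fun w => if w = [] then 1 else 0, by simp⟩⟩

noncomputable instance : Inv SeriesGroup :=
  ⟨fun f => ⟨invCoeff f.coeff, invCoeff_nil _⟩⟩

theorem coeff_mul (f g : SeriesGroup) : (f * g).coeff = conv f.coeff g.coeff := rfl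

theorem coeff_one (w : List ℕ+) : (1 : SeriesGroup).coeff w = if w = [] then 1 else 0 := rfl

theorem coeff_inv (f : SeriesGroup) : (f⁻¹).coeff = invCoeff f.coeff := rfl

theorem mul_one_aux (f : SeriesGroup) : f * 1 = f := by
  have key : ∀ (w : List ℕ+) (h : List ℕ+ → ℂ), conv h (1 : SeriesGroup).coeff w = h w := by
    intro w
    induction w with
    | nil => intro h; simp [conv_nil, coeff_one]
    | cons i w ih => intro h; rw [conv_cons, ih]; simp [coeff_one]
  ext w
  rw [coeff_mul, key]

theorem mul_inv_aux (f : SeriesGroup) : f * f⁻¹ = 1 := by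
  ext w
  cases w with
  | nil => rw [(f * f⁻¹).coeff_nil, coeff_nil]
  | cons i w =>
    rw [coeff_mul, conv_cons, coeff_inv, invCoeff_cons, f.coeff_nil, coeff_one]
    simp

noncomputable instance : Group SeriesGroup :=
  Group.ofRightAxioms
    (fun f g h => by ext w; exact conv_assoc _ _ _ w) mul_one_aux mul_inv_aux

/-- The weakest topology in which all coefficients are continuous. -/
noncomputable instance : TopologicalSpace SeriesGroup :=
  TopologicalSpace.induced SeriesGroup.coeff inferInstance

theorem continuous_coeff (w : List ℕ+) : Continuous fun f : SeriesGroup => f.coeff w :=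
  (continuous_apply w).comp continuous_induced_dom

instance : IsTopologicalGroup SeriesGroup where
  continuous_mul := by
    refine continuous_induced_rng.2 (continuous_pi fun w => ?_)
    change Continuous fun p : SeriesGroup × SeriesGroup => conv p.1.coeff p.2.coeff w
    unfold conv
    exact continuous_finsetSum _ fun k _ =>
      ((continuous_coeff _).comp continuous_fst).mul ((continuous_coeff _).comp continuous_snd)
  continuous_inv := by
    refine continuous_induced_rng.2 (continuous_pi fun w => ?_)
    change Continuous fun f : SeriesGroup => invCoeff f.coeff w
    have key : ∀ (n : ℕ) (w : List ℕ+), w.length ≤ n →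
        Continuous fun f : SeriesGroup => invCoeff f.coeff w := by
      intro n
      induction n with
      | zero =>
        intro w hw
        obtain rfl : w = [] := List.length_eq_zero_iff.1 (Nat.le_zero.1 hw)
        simp only [invCoeff_nil]
        exact continuous_const
      | succ n ih =>
        intro w hw
        cases w with
        | nil =>
          simp only [invCoeff_nil]
          exact continuous_const
        | cons i w =>
          simp only [invCoeff_cons, conv]
          refine (continuous_finsetSum _ fun k _ => (continuous_coeff _).mul (ih _ ?_)).neg
          simp only [List.length_cons] at hw
          simp only [List.length_drop]
          omega
    exact key _ w le_rfl

end SeriesGroup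

/-! ## The semigroup `X` of coefficient sequences -/

/-- The set `X` of sequences `a = (a₁, a₂, …)` of bounded measurable complex functions on `[0, T]`
such that `sup_{x, i} |a_i(x)|^{1/i} < ∞`, i.e. `|a_i(x)| ≤ Cⁱ` for some `C` and all `x ∈ [0, T]` and
`i ≥ 1`. The functions are written on the whole line; only their values on `[0, T]` are used. -/
structure PathData (T : ℝ) where
  /-- The functions `a_i`. -/
  toFun : ℕ+ → ℝ → ℂ
  measurable : ∀ i, Measurable (toFun i)
  bounded : ∃ C : ℝ, 0 ≤ C ∧ ∀ i, ∀ x ∈ Set.Icc 0 T, ‖toFun i x‖ ≤ C ^ (i : ℕ)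

namespace PathData

variable {T : ℝ}

/-- The product `a * b`: first follow `b`, then `a`. -/
noncomputable instance : Mul (PathData T) where
  mul a b :=
    { toFun := fun i x =>
        if x ≤ T / 2 then 2 * b.toFun i (2 * x) else 2 * a.toFun i (2 * x - T)
      measurable := fun i => by
        refine Measurable.ite measurableSet_Iic ?_ ?_
        · exact ((b.measurable i).comp (measurable_const.mul measurable_id)).const_mul 2
        · exact ((a.measurable i).comp
            ((measurable_const.mul measurable_id).sub_const T)).const_mul 2
      bounded := by
        obtain ⟨A, hA, ha⟩ := a.bounded
        obtain ⟨B, hB, hb⟩ := b.bounded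
        refine ⟨2 * max A B, by positivity, fun i x hx => ?_⟩
        have h2 : (2 : ℝ) ≤ 2 ^ (i : ℕ) := le_self_pow₀ (by norm_num) i.ne_zero
        have hAB : 0 ≤ max A B := le_max_of_le_left hA
        rw [mul_pow]
        split_ifs with h
        · rw [norm_mul, Complex.norm_ofNat]
          refine mul_le_mul h2 ((hb i _ ⟨by linarith [hx.1], by linarith⟩).trans ?_)
            (norm_nonneg _) (by positivity)
          exact pow_le_pow_left₀ hB (le_max_right _ _) _
        · rw [norm_mul, Complex.norm_ofNat]
          refine mul_le_mul h2
            ((ha i _ ⟨by linarith [not_le.1 h], by linarith [hx.2]⟩).trans ?_)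
            (norm_nonneg _) (by positivity)
          exact pow_le_pow_left₀ hA (le_max_left _ _) _ }

/-- The inverse path `a⁻¹(x) = -a(T - x)`. -/
noncomputable instance : Inv (PathData T) where
  inv a :=
    { toFun := fun i x => -a.toFun i (T - x)
      measurable := fun i => ((a.measurable i).comp (measurable_const.sub measurable_id)).neg
      bounded := by
        obtain ⟨A, hA, ha⟩ := a.bounded
        refine ⟨A, hA, fun i x hx => ?_⟩
        rw [norm_neg]
        exact ha i _ ⟨by linarith [hx.2], by linarith [hx.1]⟩ }

/-- The constant path. -/
instance : One (PathData T) where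
  one :=
    { toFun := fun _ _ => 0
      measurable := fun _ => measurable_const
      bounded := ⟨0, le_rfl, fun i x _ => by simp⟩ }

theorem mul_toFun (a b : PathData T) (i : ℕ+) (x : ℝ) : (a * b).toFun i x =
    if x ≤ T / 2 then 2 * b.toFun i (2 * x) else 2 * a.toFun i (2 * x - T) := rfl

theorem inv_toFun (a : PathData T) (i : ℕ+) (x : ℝ) :
    (a⁻¹).toFun i x = -a.toFun i (T - x) := rfl

end PathData

/-! ## Iterated integrals -/

/-- The iterated integral with the functions listed from the outermost one (at the largest time)
to the innermost one (at the smallest time):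
`iterInt [f_k, …, f_1] x = ∫⋯∫_{0 ≤ s_1 ≤ ⋯ ≤ s_k ≤ x} f_k(s_k) ⋯ f_1(s_1) ds`;
it equals `1` for `k = 0`. -/
noncomputable def iterInt : List (ℝ → ℂ) → ℝ → ℂ
  | [] => fun _ => 1
  | f :: l => fun x => ∫ s in (0 : ℝ)..x, f s * iterInt l s

variable {T : ℝ}

/-- The basic iterated integral
`I_{i₁,…,iₖ}(a) = ∫⋯∫_{0 ≤ s₁ ≤ ⋯ ≤ sₖ ≤ T} a_{iₖ}(sₖ) ⋯ a_{i₁}(s₁) dsₖ ⋯ ds₁`. -/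
noncomputable def basicIntegral (w : List ℕ+) (a : PathData T) : ℂ :=
  iterInt (w.reverse.map a.toFun) T

/-- The map `E : X → G`, the monodromy `E(a) = F_a(T)` of `F' = (∑ᵢ aᵢ(x) tⁱ Xᵢ) F`, `F(0) = I`.
By Picard iteration `F_a(T) = I + ∑ I_{i₁,…,iₖ}(a) X_{iₖ} ⋯ X_{i₁} t^{i₁ + ⋯ + iₖ}`. -/
noncomputable def E (a : PathData T) : SeriesGroup where
  coeff w := basicIntegral w.reverse a
  coeff_nil := rfl

theorem E_coeff (a : PathData T) (w : List ℕ+) :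
    (E a).coeff w = iterInt (w.map a.toFun) T := by
  simp [E, basicIntegral]

theorem aux_intervalIntegrable {f g : ℝ → ℂ} (hf : Measurable f) {C : ℝ}
    (hC : ∀ x ∈ Set.Icc 0 T, ‖f x‖ ≤ C) (hg : ContinuousOn g (Set.Icc 0 T)) {x y : ℝ}
    (hx : x ∈ Set.Icc 0 T) (hy : y ∈ Set.Icc 0 T) :
    IntervalIntegrable (fun s => f s * g s) MeasureTheory.volume x y := by
  have hsub : Set.uIcc x y ⊆ Set.Icc 0 T := Set.ordConnected_Icc.uIcc_subset hx hy
  have hgi : IntervalIntegrable g MeasureTheory.volume x y :=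
    (hg.mono hsub).intervalIntegrable
  rw [intervalIntegrable_iff] at hgi ⊢
  refine MeasureTheory.Integrable.bdd_mul hgi hf.aestronglyMeasurable (c := C) ?_
  refine (MeasureTheory.ae_restrict_iff' measurableSet_uIoc).2 (Filter.Eventually.of_forall ?_)
  exact fun s hs => hC s (hsub (Set.uIoc_subset_uIcc hs))

theorem continuousOn_iterInt (a : PathData T) (hT : 0 ≤ T) (w : List ℕ+) :
    ContinuousOn (iterInt (w.map a.toFun)) (Set.Icc 0 T) := by
  induction w with
  | nil => exact continuousOn_const
  | cons i w ih =>
    obtain ⟨C, -, hC⟩ := a.bounded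
    have h := aux_intervalIntegrable (a.measurable i) (hC i) ih
      (Set.left_mem_Icc.2 hT) (Set.right_mem_Icc.2 hT)
    have := intervalIntegral.continuousOn_primitive_interval' h Set.left_mem_uIcc
    rwa [Set.uIcc_of_le hT] at this

theorem integrable_iterInt (a : PathData T) (hT : 0 ≤ T) (i : ℕ+) (w : List ℕ+) {x y : ℝ}
    (hx : x ∈ Set.Icc 0 T) (hy : y ∈ Set.Icc 0 T) :
    IntervalIntegrable (fun s => a.toFun i s * iterInt (w.map a.toFun) s)
      MeasureTheory.volume x y := by
  obtain ⟨C, -, hC⟩ := a.bounded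
  exact aux_intervalIntegrable (a.measurable i) (hC i) (continuousOn_iterInt a hT w) hx hy

/-- Integration of a convolution over its first factor. -/
theorem integral_conv (a : PathData T) (hT : 0 ≤ T) (i : ℕ+) (g : List ℕ+ → ℂ) (w : List ℕ+)
    {x : ℝ} (hx : x ∈ Set.Icc 0 T) :
    ∫ s in (0 : ℝ)..x, a.toFun i s * conv (fun u => iterInt (u.map a.toFun) s) g w =
      conv (fun u => iterInt ((i :: u).map a.toFun) x) g w := by
  simp only [conv, Finset.mul_sum]
  rw [intervalIntegral.integral_finsetSum]
  · refine Finset.sum_congr rfl fun k _ => ?_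
    simp only [← mul_assoc]
    rw [intervalIntegral.integral_mul_const]
    rfl
  · intro k _
    simp only [← mul_assoc]
    exact (integrable_iterInt a hT i _ (Set.left_mem_Icc.2 hT) hx).mul_const _

theorem iterInt_mul_left (a b : PathData T) (w : List ℕ+) {x : ℝ} (hx : x ≤ T / 2)
    (hT : 0 ≤ T) : iterInt (w.map (a * b).toFun) x = iterInt (w.map b.toFun) (2 * x) := by
  induction w generalizing x with
  | nil => rfl
  | cons i w ih =>
    simp only [List.map_cons, iterInt]
    have := intervalIntegral.smul_integral_comp_mul_left (a := 0) (b := x)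
      (fun s => b.toFun i s * iterInt (w.map b.toFun) s) 2
    rw [mul_zero] at this
    rw [← this, ← intervalIntegral.integral_smul]
    refine intervalIntegral.integral_congr fun s hs => ?_
    have hs' : s ≤ T / 2 := by
      rcases le_total 0 x with h | h
      · rw [Set.uIcc_of_le h] at hs; exact hs.2.trans hx
      · rw [Set.uIcc_of_ge h] at hs; linarith [hs.2]
    simp only [ih hs', PathData.mul_toFun, if_pos hs', Complex.real_smul]
    push_cast
    ring

theorem iterInt_mul_right (a b : PathData T) (hT : 0 ≤ T) (w : List ℕ+) {x : ℝ}
    (hx : x ∈ Set.Icc (T / 2) T) : iterInt (w.map (a * b).toFun) x =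
      conv (fun u => iterInt (u.map a.toFun) (2 * x - T))
        (fun v => iterInt (v.map b.toFun) T) w := by
  induction w generalizing x with
  | nil => simp [conv_nil, iterInt]
  | cons i w ih =>
    have hhalf : T / 2 ∈ Set.Icc 0 T := ⟨by linarith, by linarith⟩
    have hx0 : x ∈ Set.Icc 0 T := ⟨by linarith [hx.1], hx.2⟩
    have h1 := iterInt_mul_left a b (i :: w) (x := T / 2) le_rfl hT
    rw [mul_div_cancel₀ T two_ne_zero] at h1
    have hsplit := intervalIntegral.integral_add_adjacent_intervals
      (integrable_iterInt (a * b) hT i w (Set.left_mem_Icc.2 hT) hhalf)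
      (integrable_iterInt (a * b) hT i w hhalf hx0)
    have h0 : iterInt ((i :: w).map (a * b).toFun) x =
        iterInt ((i :: w).map (a * b).toFun) (T / 2) +
          ∫ s in (T / 2)..x, (a * b).toFun i s * iterInt (w.map (a * b).toFun) s := hsplit.symm
    rw [h0, h1, conv_cons, add_comm]
    simp only [List.map_nil]
    rw [show iterInt [] (2 * x - T) = 1 from rfl, one_mul]
    congr 1
    rw [← integral_conv a hT i _ w (x := 2 * x - T)
      ⟨by linarith [hx.1], by linarith [hx.2]⟩]
    have := intervalIntegral.smul_integral_comp_mul_sub (a := T / 2) (b := x)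
      (fun s => a.toFun i s * conv (fun u => iterInt (u.map a.toFun) s)
        (fun v => iterInt (v.map b.toFun) T) w) 2 T
    rw [mul_div_cancel₀ T two_ne_zero, sub_self] at this
    rw [← this, ← intervalIntegral.integral_smul]
    refine intervalIntegral.integral_congr_ae (Filter.Eventually.of_forall fun s hs => ?_)
    rw [Set.uIoc_of_le hx.1] at hs
    have hs' : s ∈ Set.Icc (T / 2) T := ⟨hs.1.le, hs.2.trans hx.2⟩
    simp only [ih hs', PathData.mul_toFun, if_neg (not_le.2 hs.1), Complex.real_smul]
    push_cast
    ring

theorem iterInt_inv (a : PathData T) (hT : 0 ≤ T) (w : List ℕ+) {x : ℝ}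
    (hx : x ∈ Set.Icc 0 T) :
    conv (fun u => iterInt (u.map (a⁻¹).toFun) x) (fun v => iterInt (v.map a.toFun) T) w =
      iterInt (w.map a.toFun) (T - x) := by
  induction w generalizing x with
  | nil => simp [conv_nil, iterInt]
  | cons i w ih =>
    rw [conv_cons, ← integral_conv a⁻¹ hT i _ w hx]
    simp only [List.map_nil]
    rw [show iterInt [] x = 1 from rfl, one_mul]
    have hTx : T - x ∈ Set.Icc 0 T := ⟨by linarith [hx.2], by linarith [hx.1]⟩
    have hsplit := intervalIntegral.integral_add_adjacent_intervals
      (integrable_iterInt a hT i w (Set.left_mem_Icc.2 hT) hTx)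
      (integrable_iterInt a hT i w hTx (Set.right_mem_Icc.2 hT))
    have h0 : iterInt ((i :: w).map a.toFun) (T - x) +
        (∫ s in (T - x)..T, a.toFun i s * iterInt (w.map a.toFun) s) =
          iterInt ((i :: w).map a.toFun) T := hsplit
    have hrev : ∫ s in (0 : ℝ)..x, (a⁻¹).toFun i s *
        conv (fun u => iterInt (u.map (a⁻¹).toFun) s) (fun v => iterInt (v.map a.toFun) T) w =
        -∫ s in (T - x)..T, a.toFun i s * iterInt (w.map a.toFun) s := by
      have := intervalIntegral.integral_comp_sub_left (a := 0) (b := x)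
        (fun s => a.toFun i s * iterInt (w.map a.toFun) s) T
      rw [sub_zero] at this
      rw [← this, ← intervalIntegral.integral_neg]
      refine intervalIntegral.integral_congr fun s hs => ?_
      rw [Set.uIcc_of_le hx.1] at hs
      simp only [ih ⟨hs.1, hs.2.trans hx.2⟩, PathData.inv_toFun, neg_mul]
    rw [hrev, ← h0]
    ring

theorem E_mul (hT : 0 ≤ T) (a b : PathData T) : E (a * b) = E a * E b := by
  ext w
  rw [SeriesGroup.coeff_mul, E_coeff, iterInt_mul_right a b hT w ⟨by linarith, le_rfl⟩]
  simp only [conv, E_coeff, two_mul, add_sub_cancel_right]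

theorem E_one : E (1 : PathData T) = 1 := by
  ext w
  rw [E_coeff, SeriesGroup.coeff_one]
  cases w with
  | nil => rfl
  | cons i w =>
    have : (1 : PathData T).toFun i = fun _ => 0 := rfl
    simp [iterInt, this]

theorem E_inv (hT : 0 ≤ T) (a : PathData T) : E a⁻¹ = (E a)⁻¹ := by
  refine eq_inv_of_mul_eq_one_left ?_
  ext w
  have h := iterInt_inv a hT w (Set.right_mem_Icc.2 hT)
  rw [sub_self] at h
  rw [SeriesGroup.coeff_mul, SeriesGroup.coeff_one]
  simp only [conv, E_coeff] at h ⊢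
  rw [h]
  cases w with
  | nil => rfl
  | cons i w => simp [iterInt]

/-- Two sequences have the same image under `E` exactly when they are equivalent, i.e. when all
basic iterated integrals (of positive order) vanish at `a * b⁻¹`. So the range of `E` is the group
of equivalence classes. -/
theorem E_eq_E_iff (hT : 0 ≤ T) (a b : PathData T) :
    E a = E b ↔ ∀ w : List ℕ+, w ≠ [] → basicIntegral w (a * b⁻¹) = 0 := by
  rw [← mul_inv_eq_one, ← E_inv hT, ← E_mul hT]
  constructor
  · intro h w hw
    have := congrArg (fun f => SeriesGroup.coeff f w.reverse) h
    simpa [E, SeriesGroup.coeff_one, hw] using this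
  · intro h
    ext w
    rw [SeriesGroup.coeff_one]
    split_ifs with hw
    · subst hw; rfl
    · exact h w.reverse (by simpa using hw)

/-! ## The groups of paths, formal paths, closed paths and formal closed paths -/

/-- The set `X_*` of `a ∈ X` whose first integral is a closed path: `I_s(a) = 0` for all `s`. -/
def closedPaths (T : ℝ) : Set (PathData T) :=
  {a | ∀ s : ℕ+, basicIntegral [s] a = 0}

theorem mem_closedPaths_iff (a : PathData T) :
    a ∈ closedPaths T ↔ ∀ s : ℕ+, (E a).coeff [s] = 0 := Iff.rfl

variable (T) [hT : Fact (0 < T)]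

/-- The group of paths `G(X)`, identified with its image in `G`. -/
noncomputable def pathGroup : Subgroup SeriesGroup where
  carrier := Set.range (E : PathData T → SeriesGroup)
  one_mem' := ⟨1, E_one⟩
  mul_mem' := by
    rintro _ _ ⟨a, rfl⟩ ⟨b, rfl⟩
    exact ⟨a * b, E_mul hT.out.le a b⟩
  inv_mem' := by
    rintro _ ⟨a, rfl⟩
    exact ⟨a⁻¹, E_inv hT.out.le a⟩

/-- The group of formal paths `G_f(X)`, the completion of `G(X)`, identified with the closure of
`G(X)` in `G` (which is complete, with the topology of coefficientwise convergence). -/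
noncomputable def formalPathGroup : Subgroup SeriesGroup :=
  (pathGroup T).topologicalClosure

/-- The subgroup of closed paths `G(X_*)`, the image of `X_*`. -/
noncomputable def closedPathGroup : Subgroup SeriesGroup where
  carrier := (E : PathData T → SeriesGroup) '' closedPaths T
  one_mem' := by
    refine ⟨1, ?_, E_one⟩
    rw [mem_closedPaths_iff]
    intro s
    rw [E_one, SeriesGroup.coeff_one]
    simp
  mul_mem' := by
    rintro _ _ ⟨a, ha, rfl⟩ ⟨b, hb, rfl⟩
    refine ⟨a * b, ?_, E_mul hT.out.le a b⟩
    rw [mem_closedPaths_iff] at ha hb ⊢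
    intro s
    rw [E_mul hT.out.le, SeriesGroup.coeff_mul, conv_cons, conv_nil, ha, hb]
    simp
  inv_mem' := by
    rintro _ ⟨a, ha, rfl⟩
    refine ⟨a⁻¹, ?_, E_inv hT.out.le a⟩
    rw [mem_closedPaths_iff] at ha ⊢
    intro s
    rw [E_inv hT.out.le, SeriesGroup.coeff_inv, invCoeff_cons, conv_nil, ha]
    simp

/-- The subgroup of formal closed paths `G_f(X_*)`, the closure of `G(X_*)`. Since `G_f(X)` is
closed in `G`, closures in `G_f(X)` and in `G` agree. -/
noncomputable def formalClosedPathGroup : Subgroup SeriesGroup :=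
  (closedPathGroup T).topologicalClosure

theorem E_mem_formalPathGroup (a : PathData T) : E a ∈ formalPathGroup T :=
  (pathGroup T).le_topologicalClosure ⟨a, rfl⟩

theorem formalClosedPathGroup_le : formalClosedPathGroup T ≤ formalPathGroup T :=
  Subgroup.topologicalClosure_mono (by rintro _ ⟨a, -, rfl⟩; exact ⟨a, rfl⟩)

/-- The `n`-th term `closure Kₙ` of the topological lower central series of a topological group `K`,
where `K₁ = [K, K]` and `Kₙ = [K, Kₙ₋₁]` (and `K₀ = K`). -/
def topLowerCentralSeries (K : Type*) [Group K] [TopologicalSpace K] (n : ℕ) : Set K :=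
  closure ((⊤ : Subgroup K).lowerCentralSeries n : Set K)

/-! ## Moments -/

/-- Index of an element `ã_{i₁}^{n₁} ⋯ ã_{iₖ}^{nₖ} · a_j` of `𝒫(X)`: the list of the pairs
`(i_r, n_r)` together with `j`. -/
abbrev MomentFactor : Type := List (ℕ+ × ℕ) × ℕ+

variable {T}

/-- The value at `x` of the element of `𝒫(X)` with the given index, where
`ã_i(x) = ∫_0^x a_i(s) ds`. -/
noncomputable def MomentFactor.eval (p : MomentFactor) (a : PathData T) (x : ℝ) : ℂ :=
  (p.1.map fun q => (∫ s in (0 : ℝ)..x, a.toFun q.1 s) ^ q.2).prod * a.toFun p.2 x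

/-- The moment on `X` of order `k` given by the list `[p₁, …, pₖ]`:
`m(a) = ∫⋯∫_{0 ≤ s₁ ≤ ⋯ ≤ sₖ ≤ T} pₖ(a; sₖ) ⋯ p₁(a; s₁) dsₖ ⋯ ds₁`. -/
noncomputable def moment (P : List MomentFactor) (a : PathData T) : ℂ :=
  iterInt (P.reverse.map fun p => p.eval a) T

/-- A function on `G_f(X)` is a moment of order `k` if it is the continuous extension to `G_f(X)` of
the function on `G(X)` induced by a moment of order `k` on `X`. -/
def IsMoment (k : ℕ) (m : formalPathGroup T → ℂ) : Prop :=
  Continuous m ∧ ∃ P : List MomentFactor, P.length = k ∧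
    ∀ a : PathData T, m ⟨E a, E_mem_formalPathGroup T a⟩ = moment P a

end FormalPaths

namespace FormalPaths

open scoped commutatorElement

/-! ## Filtrations of the group of series -/

section Filtration

/-! A moment of order `k` is an iterated integral of `k` polynomial one-forms `x^μ dx_j` along the
first integral of the path. Encoding each form as a letter turns all of these integrals into the
coefficients of one series, `momentSeries g`; for `g = E a` it is the monodromy of `formPath a`.
Each coefficient is a finite sum of coefficients of `g`, hence continuous in `g`.

A closed path brings every `ã_i` back to `0`, so the forms along `a * b` are the forms along `b`
followed by those along `a`. Hence `momentSeries` is a homomorphism on formal closed paths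
(`momentSeries_mul`). Each commutator raises the order in the length filtration by one, so on the
`n`-th term of the lower central series the moments of order at most `n` vanish, and by continuity
they vanish on its closure.

Conversely, suppose that these moments vanish at `g`. The leading terms of `g` are removed by
elements of the lower central series of `G(X_*)` itself, weight by weight and, inside a weight `d`,
length by length. Let `φ` be the moments of weight `d` and length `m + 1`, all shorter ones of this
weight and all those of smaller weight being zero. Then `φ` kills exact forms in each slot, because
integrating one out leaves words of length `m`; and it kills proper shuffles, because these are
products of moments of smaller weight. By the Dynkin–Specht–Wever theorem (`dyn_eq_of_shuffle`), `(m
+ 1) φ` is a combination of nested brackets of functionals on forms, and these may be taken among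
the `dualForm q`, which annihilate exact forms (`sum_mul_dualForm`). Iterated commutators of
straight paths are closed paths with these functionals as leading moments of order one
(`exists_formCoeff_eq_dualForm`), and nested commutators of such closed paths have the nested
brackets as leading moments (`exists_formCoeff_eq_nested`). So a product of nested commutators has
the leading moments of `g` (`exists_formCoeff_eq`). Dividing by it and repeating gives
approximations that converge to `g` coefficientwise (`mem_closure_lowerCentralSeries`).

Because the approximating elements lie in `G(X_*)`, the closures of the two lower central series in
`G` coincide, which also yields the second statement. -/

/-- The total size of a word, given the sizes of its letters. -/
def wordSize (σ : ℕ+ → ℕ) (w : List ℕ+) : ℕ := (w.map σ).sum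

theorem wordSize_nil (σ : ℕ+ → ℕ) : wordSize σ [] = 0 := rfl

theorem wordSize_cons (σ : ℕ+ → ℕ) (i : ℕ+) (w : List ℕ+) :
    wordSize σ (i :: w) = σ i + wordSize σ w := by simp [wordSize]

theorem wordSize_append (σ : ℕ+ → ℕ) (u v : List ℕ+) :
    wordSize σ (u ++ v) = wordSize σ u + wordSize σ v := by simp [wordSize]

theorem wordSize_take_add_drop (σ : ℕ+ → ℕ) (w : List ℕ+) (k : ℕ) :
    wordSize σ (w.take k) + wordSize σ (w.drop k) = wordSize σ w := by
  rw [← wordSize_append, List.take_append_drop]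

theorem length_le_wordSize {σ : ℕ+ → ℕ} (hσ : ∀ i, 1 ≤ σ i) (w : List ℕ+) :
    w.length ≤ wordSize σ w := by
  induction w with
  | nil => simp
  | cons i w ih => rw [wordSize_cons, List.length_cons]; have := hσ i; omega

theorem wordSize_one (w : List ℕ+) : wordSize (fun _ => 1) w = w.length := by
  simp [wordSize]

theorem wordSize_pos {σ : ℕ+ → ℕ} (hσ : ∀ i, 1 ≤ σ i) {w : List ℕ+} (hw : w ≠ []) :
    0 < wordSize σ w :=
  (List.length_pos_iff.2 hw).trans_le (length_le_wordSize hσ w)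

/-- The subgroup of the series without nonconstant terms of size less than `d`. -/
noncomputable def filt (σ : ℕ+ → ℕ) (d : ℕ) : Subgroup SeriesGroup where
  carrier := {f | ∀ w ≠ [], wordSize σ w < d → f.coeff w = 0}
  one_mem' := fun w hw _ => by simp [SeriesGroup.coeff_one, hw]
  mul_mem' := by
    intro f g hf hg w hw hd
    rw [SeriesGroup.coeff_mul]
    refine Finset.sum_eq_zero fun k _ => ?_
    have h := wordSize_take_add_drop σ w k
    by_cases h1 : w.take k = []
    · have h2 : w.drop k ≠ [] := fun h2 => hw (by rw [← List.take_append_drop k w, h1, h2]; rfl)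
      rw [hg _ h2 (by omega), mul_zero]
    · rw [hf _ h1 (by omega), zero_mul]
  inv_mem' := by
    intro f hf w hw hd
    rw [SeriesGroup.coeff_inv]
    cases w with
    | nil => exact absurd rfl hw
    | cons i w =>
      rw [invCoeff_cons, neg_eq_zero]
      refine Finset.sum_eq_zero fun k _ => ?_
      have h := wordSize_take_add_drop σ w k
      rw [wordSize_cons] at hd
      have h0 : f.coeff (i :: w.take k) = 0 := hf _ (by simp) (by rw [wordSize_cons]; omega)
      simp only [h0, zero_mul]

theorem mem_filt_one {σ : ℕ+ → ℕ} (hσ : ∀ i, 1 ≤ σ i) (f : SeriesGroup) : f ∈ filt σ 1 :=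
  fun _ hw h => absurd (wordSize_pos hσ hw) (by omega)

/-- The part of a product of series that involves the nonconstant terms of both factors. -/
noncomputable def mid (f g : SeriesGroup) (w : List ℕ+) : ℂ :=
  ∑ k ∈ Finset.Ico 1 w.length, f.coeff (w.take k) * g.coeff (w.drop k)

theorem coeff_mul_eq_mid (f g : SeriesGroup) {w : List ℕ+} (hw : w ≠ []) :
    (f * g).coeff w = f.coeff w + g.coeff w + mid f g w := by
  have hl : 0 < w.length := List.length_pos_iff.2 hw
  rw [SeriesGroup.coeff_mul, conv, Finset.sum_range_succ, Finset.range_eq_Ico,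
    Finset.sum_eq_sum_Ico_succ_bot hl, mid]
  simp [f.coeff_nil, g.coeff_nil]
  ring

/-- Whenever a word of size below `c + d` is cut in two, the first piece has size below `c` or the
second has size below `d`. -/
theorem mid_eq_zero {σ : ℕ+ → ℕ} {c d : ℕ} {f g : SeriesGroup} (hf : f ∈ filt σ c)
    (hg : g ∈ filt σ d) {w : List ℕ+} (hw : wordSize σ w < c + d) : mid f g w = 0 := by
  refine Finset.sum_eq_zero fun k hk => ?_
  rw [Finset.mem_Ico] at hk
  have h := wordSize_take_add_drop σ w k
  have h1 : w.take k ≠ [] := by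
    rw [← List.length_pos_iff, List.length_take]; omega
  have h2 : w.drop k ≠ [] := by
    rw [← List.length_pos_iff, List.length_drop]; omega
  rcases lt_or_ge (wordSize σ (w.take k)) c with hc | hc
  · rw [hf _ h1 hc, zero_mul]
  · rw [hg _ h2 (by omega), mul_zero]

theorem coeff_mul_of_lt {σ : ℕ+ → ℕ} {c d : ℕ} {f g : SeriesGroup} (hf : f ∈ filt σ c)
    (hg : g ∈ filt σ d) {w : List ℕ+} (hw : w ≠ []) (h : wordSize σ w < c + d) :
    (f * g).coeff w = f.coeff w + g.coeff w := by
  rw [coeff_mul_eq_mid f g hw, mid_eq_zero hf hg h, add_zero]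

/-- Compare coefficients in `⁅f, g⁆ (g f) = f g`; the linear contributions of `f` and `g` cancel. -/
theorem coeff_commutator_eq (f g : SeriesGroup) {w : List ℕ+} (hw : w ≠ []) :
    ⁅f, g⁆.coeff w = mid f g w - mid g f w - mid ⁅f, g⁆ (g * f) w := by
  have h : ⁅f, g⁆ * (g * f) = f * g := by rw [commutatorElement_def]; group
  have h1 := congrArg (fun x => SeriesGroup.coeff x w) h
  simp only [coeff_mul_eq_mid _ _ hw] at h1
  linear_combination h1

theorem commutator_mem_filt {σ : ℕ+ → ℕ} (hσ : ∀ i, 1 ≤ σ i) {c d : ℕ} {f g : SeriesGroup}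
    (hf : f ∈ filt σ c) (hg : g ∈ filt σ d) : ⁅f, g⁆ ∈ filt σ (c + d) := by
  -- Bootstrapping: since `g * f` has no nonconstant term of size below `1`, knowing the order of
  -- the commutator up to `n` makes the correction term vanish at size `n`.
  have key : ∀ n : ℕ, n ≤ c + d → ⁅f, g⁆ ∈ filt σ n := by
    intro n
    induction n with
    | zero => intro _ w _ h; exact absurd h (by omega)
    | succ n ih =>
      intro hn w hw h
      rw [coeff_commutator_eq f g hw, mid_eq_zero hf hg (by omega),
        mid_eq_zero hg hf (by omega),
        mid_eq_zero (ih (by omega)) (mem_filt_one hσ (g * f)) h]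
      simp
  exact key _ le_rfl

/-- The leading part of a group commutator is the Lie bracket of the leading parts. -/
theorem coeff_commutator {σ : ℕ+ → ℕ} (hσ : ∀ i, 1 ≤ σ i) {c d : ℕ} {f g : SeriesGroup}
    (hf : f ∈ filt σ c) (hg : g ∈ filt σ d) {w : List ℕ+} (hw : w ≠ [])
    (h : wordSize σ w = c + d) :
    ⁅f, g⁆.coeff w = mid f g w - mid g f w := by
  rw [coeff_commutator_eq f g hw, mid_eq_zero (commutator_mem_filt hσ hf hg)
    (mem_filt_one hσ (g * f)) (by omega), sub_zero]

/-- The terms of least length of a commutator with a series of order `m`. -/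
theorem coeff_commutator_length {m : ℕ} {f g : SeriesGroup}
    (hg : g ∈ filt (fun _ => 1) m) {w : List ℕ+} (hm : 1 ≤ m) (h : w.length = m + 1) :
    ⁅f, g⁆.coeff w = f.coeff [w.headI] * g.coeff w.tail -
      g.coeff w.dropLast * f.coeff [w.getLastI] := by
  have hw : w ≠ [] := by rw [← List.length_pos_iff]; omega
  rw [coeff_commutator (σ := fun _ => 1) (fun _ => le_rfl) (mem_filt_one (fun _ => le_rfl) f) hg hw
    (by rw [wordSize_one]; omega)]
  congr 1
  · rw [mid, Finset.sum_eq_single_of_mem 1 (by simp; omega)]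
    · cases w with
      | nil => exact absurd rfl hw
      | cons i w => simp
    · intro k hk hk1
      rw [Finset.mem_Ico] at hk
      rw [hg (w.drop k) _ _, mul_zero]
      · rw [← List.length_pos_iff, List.length_drop]; omega
      · rw [wordSize_one, List.length_drop]; omega
  · rw [mid, Finset.sum_eq_single_of_mem m (by simp; omega)]
    · congr 2
      · rw [List.dropLast_eq_take, h]; rfl
      · obtain ⟨u, x, rfl⟩ := List.eq_nil_or_concat w |>.resolve_left hw
        have hu : u.length = m := by simpa using h
        simp [List.getLastI_eq_getLast?_getD, ← hu]
    · intro k hk hk1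
      rw [Finset.mem_Ico] at hk
      rw [hg (w.take k) _ _, zero_mul]
      · rw [← List.length_pos_iff, List.length_take]; omega
      · rw [wordSize_one, List.length_take]; omega

end Filtration

/-! ## Shuffles and the Dynkin operator -/

section Shuffle

variable {α : Type*}

/-- The sum of the values of a function over all shuffles of two words. -/
def shSum : (List α → ℂ) → List α → List α → ℂ
  | F, [], v => F v
  | F, a :: u, [] => F (a :: u)
  | F, a :: u, b :: v =>
    shSum (fun z => F (a :: z)) u (b :: v) + shSum (fun z => F (b :: z)) (a :: u) v
termination_by _ u v => u.length + v.length

theorem shSum_nil_left (F : List α → ℂ) (v : List α) : shSum F [] v = F v := by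
  rw [shSum]

theorem shSum_nil_right (F : List α → ℂ) (u : List α) : shSum F u [] = F u := by
  cases u <;> rw [shSum]

theorem shSum_cons_cons (F : List α → ℂ) (a b : α) (u v : List α) :
    shSum F (a :: u) (b :: v) =
      shSum (fun z => F (a :: z)) u (b :: v) + shSum (fun z => F (b :: z)) (a :: u) v := by
  rw [shSum]

/-- The recursion defining shuffles reads off first letters; the telescoping in `dyn_eq_of_shuffle`
needs it for last letters. -/
theorem shSum_concat_concat (F : List α → ℂ) (u v : List α) (a b : α) :
    shSum F (u ++ [a]) (v ++ [b]) =
      shSum (fun z => F (z ++ [a])) u (v ++ [b]) + shSum (fun z => F (z ++ [b])) (u ++ [a]) v := by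
  induction hn : u.length + v.length using Nat.strong_induction_on generalizing F u v with
  | _ n ih =>
    subst hn
    cases u with
    | nil =>
      cases v with
      | nil => simp [shSum_cons_cons, shSum_nil_left, shSum_nil_right, add_comm]
      | cons d v =>
        have h := ih _ (by simp) (fun z => F (d :: z)) [] v rfl
        simp only [List.nil_append, List.cons_append, shSum_cons_cons, shSum_nil_left] at h ⊢
        rw [h]
        ring
    | cons c u =>
      cases v with
      | nil =>
        have h := ih _ (by simp) (fun z => F (c :: z)) u [] rfl
        simp only [List.nil_append, List.cons_append, shSum_cons_cons, shSum_nil_right] at h ⊢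
        rw [h]
        ring
      | cons d v =>
        have h1 := ih _ (by simp) (fun z => F (c :: z)) u (d :: v) rfl
        have h2 := ih _ (by simp) (fun z => F (d :: z)) (c :: u) v rfl
        simp only [List.cons_append, shSum_cons_cons] at h1 h2 ⊢
        rw [h1, h2]
        ring

variable [Inhabited α]

/-- The adjoint of the right-nested Lie bracket of `n + 1` letters. -/
def dyn : ℕ → (List α → ℂ) → List α → ℂ
  | 0, φ, W => φ W
  | n + 1, φ, W =>
    dyn n (fun z => φ (W.headI :: z)) W.tail - dyn n (fun z => φ (W.getLastI :: z)) W.dropLast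

/-- Unwinding the bracket peels letters off the two ends of `W` until the letter at position `k` is
left. The letters peeled from the right come in reverse order and each carries a minus sign, and the
two sequences of removals interleave arbitrarily. -/
theorem dyn_eq_sum (n : ℕ) (φ : List α → ℂ) (W : List α) (hW : W.length = n + 1) :
    dyn n φ W = ∑ k ∈ Finset.range (n + 1), (-1) ^ (n - k : ℕ) *
      shSum (fun z => φ (z ++ [W.getD k default])) (W.take k) (W.drop (k + 1)).reverse := by
  induction n generalizing φ W with
  | zero =>
    obtain ⟨x, rfl⟩ := List.length_eq_one_iff.1 hW
    simp [dyn, shSum_nil_left]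
  | succ n ih =>
    obtain ⟨x, W, rfl⟩ := List.exists_cons_of_ne_nil (l := W) (by rintro rfl; simp at hW)
    obtain ⟨Y, y, rfl⟩ := List.eq_nil_or_concat W |>.resolve_left (by rintro rfl; simp at hW)
    have hY : Y.length = n := by simpa using hW
    rw [List.concat_eq_append] at *
    have hlast : (x :: (Y ++ [y])).getLastI = y := by
      rw [List.getLastI_eq_getLast?_getD, ← List.cons_append, List.getLast?_concat]
      rfl
    have hdrop : (x :: (Y ++ [y])).dropLast = x :: Y := by
      rw [← List.cons_append, List.dropLast_concat]
    rw [dyn, ih _ _ (by simp [hY]), ih _ _ (by simp [hY]), hlast, hdrop, List.tail_cons,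
      List.headI_cons, Finset.sum_range_succ, Finset.sum_range_succ' _ n,
      Finset.sum_range_succ _ (n + 1), Finset.sum_range_succ' _ n, add_sub_add_comm,
      ← Finset.sum_sub_distrib, add_assoc, add_comm (_ * _ : ℂ)]
    congr 1
    -- In an interior term both words are nonempty, and the shuffles split by their first letter,
    -- `x` or `y`.
    · refine Finset.sum_congr rfl fun k hk => ?_
      have hk : k < Y.length := by rw [hY]; exact Finset.mem_range.1 hk
      have e1 : n + 1 - (k + 1) = n - k := by omega
      have e2 : n - k = n - (k + 1) + 1 := by omega
      have e3 : (Y ++ [y]).getD k default = Y.getD k default := by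
        rw [List.getD_append _ _ _ _ hk]
      have e4 : (Y ++ [y]).take k = Y.take k := List.take_append_of_le_length hk.le
      have e5 : (Y ++ [y]).drop (k + 1) = Y.drop (k + 1) ++ [y] :=
        List.drop_append_of_le_length hk
      rw [e1, List.getD_cons_succ, List.getD_cons_succ, e3, List.take_succ_cons,
        List.take_succ_cons, e4, List.drop_succ_cons, List.drop_succ_cons, e5, List.reverse_append,
        List.reverse_singleton, List.singleton_append, shSum_cons_cons, e2, pow_succ]
      simp only [List.cons_append]
      ring
    -- In the two extreme terms one of the words is empty, so only one of the two first letters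
    -- occurs.
    · have e6 : (Y ++ [y]).getD n default = y := by simp [← hY]
      have e7 : (Y ++ [y]).take n = Y := by simp [← hY]
      have e8 : (Y ++ [y]).drop (n + 1) = [] := List.drop_eq_nil_of_le (by simp [hY])
      rw [List.getD_cons_succ, e6, List.take_succ_cons, e7, List.drop_succ_cons, e8,
        List.drop_succ_cons, e8, List.reverse_nil, shSum_nil_right, shSum_nil_right]
      simp [shSum_nil_left, pow_succ]
      ring

/-- The Dynkin–Specht–Wever theorem, in dual form: a function on words of length `n + 1` that kills
all proper shuffles is an eigenvector of the adjoint of the nested bracket. -/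
theorem dyn_eq_of_shuffle (n : ℕ) (φ : List α → ℂ) (W : List α) (hW : W.length = n + 1)
    (hφ : ∀ u v : List α, u ≠ [] → v ≠ [] → (u ++ v).Perm W → shSum φ u v = 0) :
    dyn n φ W = (n + 1) * φ W := by
  -- The vanishing shuffle of `W.take (k + 1)` with the reversed rest splits by its last letter into
  -- the terms of index `k` and `k + 1`, which are therefore opposite. Starting from `φ W` at index
  -- `n`, all signed terms equal `φ W`.
  have key : ∀ j ≤ n, shSum (fun z => φ (z ++ [W.getD (n - j) default])) (W.take (n - j))
      (W.drop (n - j + 1)).reverse = (-1) ^ j * φ W := by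
    intro j
    induction j with
    | zero =>
      intro _
      have h : W.take n ++ [W.getD n default] = W := by
        rw [List.getD_eq_getElem _ _ (by omega), List.take_append_getElem,
          List.take_of_length_le (by omega)]
      rw [Nat.sub_zero, List.drop_eq_nil_of_le (by omega), List.reverse_nil, shSum_nil_right, h]
      simp
    | succ j ih =>
      intro hj
      have ih := ih (by omega)
      obtain ⟨k, hk⟩ : ∃ k, n = j + 1 + k := ⟨n - (j + 1), by omega⟩
      have e1 : n - j = k + 1 := by omega
      have e2 : n - (j + 1) = k := by omega
      rw [e1] at ih
      rw [e2]
      have h := hφ (W.take (k + 1)) (W.drop (k + 1)).reverse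
        (by rw [← List.length_pos_iff, List.length_take]; omega)
        (by rw [← List.length_pos_iff, List.length_reverse, List.length_drop]; omega)
        (((List.reverse_perm _).append_left _).trans (by rw [List.take_append_drop]))
      have hd : W.drop (k + 1) = W.getD (k + 1) default :: W.drop (k + 1 + 1) := by
        rw [List.getD_eq_getElem _ _ (by omega)]
        exact List.drop_eq_getElem_cons (by omega)
      have ht : W.take (k + 1) = W.take k ++ [W.getD k default] := by
        rw [List.getD_eq_getElem _ _ (by omega)]
        exact (List.take_append_getElem (by omega)).symm
      rw [hd, List.reverse_cons] at h ⊢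
      rw [ht, shSum_concat_concat, ← ht, ih] at h
      rw [pow_succ]
      linear_combination h
  rw [dyn_eq_sum n φ W hW, Finset.sum_congr rfl (g := fun _ => φ W)]
  · simp
  · intro k hk
    have hk := Finset.mem_range.1 hk
    have h := key (n - k) (by omega)
    have e : n - (n - k) = k := by omega
    rw [e] at h
    rw [h, ← mul_assoc, ← mul_pow]
    simp

end Shuffle

open MeasureTheory Set

/-! ## Primitives of bounded functions -/

/-- On `[0, T]`, the function `F` is a primitive of the bounded integrable function `f`. -/
structure IsPrimitive (T : ℝ) (f F : ℝ → ℂ) : Prop where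
  integrable : IntervalIntegrable f volume 0 T
  bounded : ∃ C : ℝ, ∀ x ∈ Icc 0 T, ‖f x‖ ≤ C
  eq_add_integral : ∀ x ∈ Icc 0 T, F x = F 0 + ∫ s in (0 : ℝ)..x, f s

namespace IsPrimitive

variable {T : ℝ} {f g F G : ℝ → ℂ}

theorem intervalIntegrable (h : IsPrimitive T f F) {x y : ℝ} (hx : x ∈ Icc 0 T)
    (hy : y ∈ Icc 0 T) : IntervalIntegrable f volume x y :=
  h.integrable.mono_set (by
    rw [uIcc_of_le (hx.1.trans hx.2)]; exact ordConnected_Icc.uIcc_subset hx hy)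

theorem absolutelyContinuous (h : IsPrimitive T f F) (hT : 0 ≤ T) :
    AbsolutelyContinuousOnInterval F 0 T := by
  obtain ⟨C, hC⟩ := h.bounded
  refine LipschitzOnWith.absolutelyContinuousOnInterval (K := C.toNNReal) ?_
  rw [uIcc_of_le hT]
  refine LipschitzOnWith.of_dist_le_mul fun x hx y hy => ?_
  have h0 : (0 : ℝ) ∈ Icc 0 T := left_mem_Icc.2 hT
  have h1 : F x - F y = ∫ s in y..x, f s := by
    rw [h.eq_add_integral x hx, h.eq_add_integral y hy, add_sub_add_left_eq_sub,
      intervalIntegral.integral_interval_sub_left (h.intervalIntegrable h0 hx)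
        (h.intervalIntegrable h0 hy)]
  rw [dist_eq_norm, h1, Real.dist_eq]
  refine intervalIntegral.norm_integral_le_of_norm_le_const fun s hs => ?_
  exact (hC s (ordConnected_Icc.uIcc_subset hy hx (uIoc_subset_uIcc hs))).trans
    (Real.le_coe_toNNReal C)

theorem continuousOn (h : IsPrimitive T f F) (hT : 0 ≤ T) : ContinuousOn F (Icc 0 T) := by
  rw [← uIcc_of_le hT]
  exact (h.absolutelyContinuous hT).continuousOn

theorem integral (hf : IntervalIntegrable f volume 0 T) (hb : ∃ C : ℝ, ∀ x ∈ Icc 0 T, ‖f x‖ ≤ C) :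
    IsPrimitive T f fun x => ∫ s in (0 : ℝ)..x, f s :=
  ⟨hf, hb, fun x _ => by simp⟩

theorem const (c : ℂ) : IsPrimitive T (fun _ => 0) fun _ => c :=
  ⟨intervalIntegrable_const, ⟨0, by simp⟩, by simp⟩

theorem exists_bound (h : IsPrimitive T f F) (hT : 0 ≤ T) :
    ∃ C : ℝ, ∀ x ∈ Icc 0 T, ‖F x‖ ≤ C :=
  isCompact_Icc.exists_bound_of_continuousOn (h.continuousOn hT)

theorem ae_hasDerivAt (h : IsPrimitive T f F) :
    ∀ᵐ x, x ∈ uIcc 0 T → HasDerivAt (fun x => F 0 + ∫ s in (0 : ℝ)..x, f s) (f x) x := by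
  filter_upwards [h.integrable.ae_hasDerivAt_integral] with x hx hxT
  exact (hx hxT 0 left_mem_uIcc).const_add _

theorem congr (h : IsPrimitive T f F) {f' F' : ℝ → ℂ} (hf : ∀ x ∈ Icc 0 T, f' x = f x)
    (hF : ∀ x ∈ Icc 0 T, F' x = F x) (hT : 0 ≤ T) : IsPrimitive T f' F' := by
  obtain ⟨C, hC⟩ := h.bounded
  refine ⟨h.integrable.congr fun x hx => ?_, ⟨C, fun x hx => ?_⟩, fun x hx => ?_⟩
  · rw [uIoc_of_le hT] at hx
    exact (hf x ⟨hx.1.le, hx.2⟩).symm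
  · rw [hf x hx]; exact hC x hx
  · rw [hF x hx, hF 0 (left_mem_Icc.2 hT), h.eq_add_integral x hx]
    congr 1
    refine intervalIntegral.integral_congr fun s hs => ?_
    rw [uIcc_of_le hx.1] at hs
    exact (hf s ⟨hs.1, hs.2.trans hx.2⟩).symm

theorem mul_integrable (hf : IsPrimitive T f F) (hG : ContinuousOn G (Icc 0 T)) (hT : 0 ≤ T) :
    IntervalIntegrable (fun s => f s * G s) volume 0 T :=
  hf.integrable.mul_continuousOn (by rwa [uIcc_of_le hT])

/-- The product rule. -/
theorem mul (hf : IsPrimitive T f F) (hg : IsPrimitive T g G) (hT : 0 ≤ T) :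
    IsPrimitive T (fun x => f x * G x + F x * g x) fun x => F x * G x := by
  have hi : IntervalIntegrable (fun x => f x * G x + F x * g x) volume 0 T := by
    refine (hf.mul_integrable (hg.continuousOn hT) hT).add ?_
    simpa only [mul_comm] using hg.mul_integrable (hf.continuousOn hT) hT
  have hb : ∃ C : ℝ, ∀ x ∈ Icc 0 T, ‖f x * G x + F x * g x‖ ≤ C := by
    obtain ⟨A, hA⟩ := hf.bounded
    obtain ⟨B, hB⟩ := hg.bounded
    obtain ⟨A', hA'⟩ := hf.exists_bound hT
    obtain ⟨B', hB'⟩ := hg.exists_bound hT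
    refine ⟨A * B' + A' * B, fun x hx => (norm_add_le _ _).trans ?_⟩
    rw [norm_mul, norm_mul]
    have h1 := (norm_nonneg _).trans (hA x hx)
    have h2 := (norm_nonneg _).trans (hA' x hx)
    gcongr
    exacts [hA x hx, hB' x hx, hA' x hx, hB x hx]
  refine ⟨hi, hb, ?_⟩
  have hR := IsPrimitive.integral hi hb
  -- The difference of `F G` and its expected integral is absolutely continuous with derivative zero
  -- almost everywhere, hence constant.
  have hac : AbsolutelyContinuousOnInterval ((fun x => F x * G x) -
      fun x => ∫ s in (0 : ℝ)..x, (f s * G s + F s * g s)) 0 T :=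
    ((hf.absolutelyContinuous hT).smul (hg.absolutelyContinuous hT)).sub
      (hR.absolutelyContinuous hT)
  have hF := hf.eq_add_integral
  have hG := hg.eq_add_integral
  obtain ⟨C, hC⟩ := hac.const_of_ae_hasDerivAt_zero (by
    -- The endpoints are discarded because `F` and `G` agree with their integral formulas only on
    -- `[0, T]`, which has to be a neighbourhood of `x`.
    have hne : ∀ᵐ x : ℝ, x ∉ ({0, T} : Set ℝ) :=
      (Set.toFinite {0, T}).measure_zero volume |> compl_mem_ae_iff.2
    filter_upwards [hf.ae_hasDerivAt, hg.ae_hasDerivAt, hR.ae_hasDerivAt, hne] with x h1 h2 h3 h4 hx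
    have h := ((h1 hx).mul (h2 hx)).sub (h3 hx)
    rw [uIcc_of_le hT] at hx
    simp only [mem_insert_iff, mem_singleton_iff, not_or] at h4
    have hmem : Icc 0 T ∈ 𝓝 x :=
      Icc_mem_nhds (lt_of_le_of_ne hx.1 (Ne.symm h4.1)) (lt_of_le_of_ne hx.2 h4.2)
    rw [← hF x hx, ← hG x hx, sub_self] at h
    refine h.congr_of_eventuallyEq ?_
    filter_upwards [hmem] with y hy
    simp [hF y hy, hG y hy])
  intro x hx
  rw [uIcc_of_le hT] at hC
  have h1 := hC x hx
  have h0 := hC 0 (left_mem_Icc.2 hT)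
  simp only [Pi.sub_apply, intervalIntegral.integral_same, sub_zero] at h1 h0
  linear_combination h1 - h0

theorem eq_integral (h : IsPrimitive T f F) (h0 : F 0 = 0) {x : ℝ} (hx : x ∈ Icc 0 T) :
    F x = ∫ s in (0 : ℝ)..x, f s := by
  rw [h.eq_add_integral x hx, h0, zero_add]

end IsPrimitive

/-! ## Iterated integrals of a path -/

section Path

variable {T : ℝ}

theorem iterInt_congr {f g : ℕ+ → ℝ → ℂ} (h : ∀ i, ∀ x ∈ Icc 0 T, f i x = g i x)
    (w : List ℕ+) {x : ℝ} (hx : x ∈ Icc 0 T) :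
    iterInt (w.map f) x = iterInt (w.map g) x := by
  induction w generalizing x with
  | nil => rfl
  | cons i w ih =>
    refine intervalIntegral.integral_congr fun s hs => ?_
    rw [uIcc_of_le hx.1] at hs
    have hs' : s ∈ Icc 0 T := ⟨hs.1, hs.2.trans hx.2⟩
    simp only [h i s hs', ih hs']

theorem isPrimitive_iterInt (a : PathData T) (hT : 0 ≤ T) (i : ℕ+) (w : List ℕ+) :
    IsPrimitive T (fun s => a.toFun i s * iterInt (w.map a.toFun) s)
      (iterInt ((i :: w).map a.toFun)) := by
  refine IsPrimitive.integral
    (integrable_iterInt a hT i w (left_mem_Icc.2 hT) (right_mem_Icc.2 hT)) ?_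
  obtain ⟨C, hC0, hC⟩ := a.bounded
  obtain ⟨D, hD⟩ := isCompact_Icc.exists_bound_of_continuousOn (continuousOn_iterInt a hT w)
  refine ⟨C ^ (i : ℕ) * D, fun x hx => ?_⟩
  rw [norm_mul]
  gcongr
  exacts [hC i x hx, hD x hx]

theorem iterInt_cons_zero (f : ℝ → ℂ) (l : List (ℝ → ℂ)) : iterInt (f :: l) 0 = 0 := by
  simp [iterInt]

/-- Integration of a letter of a path against a sum over shuffles. -/
theorem integral_mul_shSum (a : PathData T) (hT : 0 ≤ T) (i : ℕ+) (u v : List ℕ+) (r : List ℕ+)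
    {x : ℝ} (hx : x ∈ Icc 0 T) :
    IntervalIntegrable
        (fun s => a.toFun i s * shSum (fun z => iterInt ((r ++ z).map a.toFun) s) u v) volume 0 x ∧
      ∫ s in (0 : ℝ)..x, a.toFun i s * shSum (fun z => iterInt ((r ++ z).map a.toFun) s) u v =
        shSum (fun z => iterInt ((i :: (r ++ z)).map a.toFun) x) u v := by
  have h0 : (0 : ℝ) ∈ Icc 0 T := left_mem_Icc.2 hT
  induction hn : u.length + v.length using Nat.strong_induction_on generalizing r u v with
  | _ n ih =>
    subst hn
    cases u with
    | nil =>
      simp only [shSum_nil_left]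
      exact ⟨integrable_iterInt a hT i _ h0 hx, rfl⟩
    | cons c u =>
      cases v with
      | nil =>
        simp only [shSum_nil_right]
        exact ⟨integrable_iterInt a hT i _ h0 hx, rfl⟩
      | cons d v =>
        have h1 := ih _ (by simp) u (d :: v) (r ++ [c]) rfl
        have h2 := ih _ (by simp) (c :: u) v (r ++ [d]) rfl
        simp only [List.append_assoc, List.singleton_append] at h1 h2
        simp only [shSum_cons_cons, mul_add]
        exact ⟨h1.1.add h2.1, by rw [intervalIntegral.integral_add h1.1 h2.1, h1.2, h2.2]⟩

/-- The shuffle relations for iterated integrals. -/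
theorem iterInt_mul_iterInt (a : PathData T) (hT : 0 ≤ T) (u v : List ℕ+) {x : ℝ}
    (hx : x ∈ Icc 0 T) :
    iterInt (u.map a.toFun) x * iterInt (v.map a.toFun) x =
      shSum (fun z => iterInt (z.map a.toFun) x) u v := by
  have h0 : (0 : ℝ) ∈ Icc 0 T := left_mem_Icc.2 hT
  induction hn : u.length + v.length using Nat.strong_induction_on generalizing u v x with
  | _ n ih =>
    subst hn
    cases u with
    | nil => rw [shSum_nil_left]; simp [iterInt]
    | cons c u =>
      cases v with
      | nil => rw [shSum_nil_right]; simp [iterInt]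
      | cons d v =>
        have hp := (isPrimitive_iterInt a hT c u).mul (isPrimitive_iterInt a hT d v) hT
        have h1 := integral_mul_shSum a hT c u (d :: v) [] hx
        have h2 := integral_mul_shSum a hT d (c :: u) v [] hx
        simp only [List.nil_append] at h1 h2
        -- The product rule is the recursion for shuffles: the outermost letter comes from `c :: u`
        -- or from `d :: v`.
        rw [hp.eq_integral (by simp [iterInt_cons_zero]) hx, shSum_cons_cons, ← h1.2, ← h2.2,
          ← intervalIntegral.integral_add h1.1 h2.1]
        refine intervalIntegral.integral_congr fun s hs => ?_
        rw [uIcc_of_le hx.1] at hs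
        have hs' : s ∈ Icc 0 T := ⟨hs.1, hs.2.trans hx.2⟩
        simp only [← ih _ (by simp) u (d :: v) hs' rfl, ← ih _ (by simp) (c :: u) v hs' rfl]
        ring

end Path

/-! ## Polynomial one-forms -/

/-- Multiplying an iterated integral by some `ã_i` thus amounts to inserting `i` at every position,
which is the operation used in `insertLetters`. -/
theorem shSum_singleton {α : Type*} (F : List α → ℂ) (i : α) (w : List α) :
    shSum F [i] w = ((List.permutations'Aux i w).map F).sum := by
  induction w generalizing F with
  | nil => simp [shSum_nil_right]
  | cons j w ih =>
    rw [shSum_cons_cons, shSum_nil_left, ih, List.permutations'Aux]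
    simp [Function.comp_def]

/-- The polynomial one-form `∏_{i ∈ μ} x_i dx_j`, indexed by `(μ, j)`. -/
abbrev Form : Type := Multiset ℕ+ × ℕ+

namespace Form

/-- The weight of a form, the variable `x_i` having weight `i`. -/
def weight (p : Form) : ℕ := (p.1.map fun i : ℕ+ => (i : ℕ)).sum + p.2

theorem one_le_weight (p : Form) : 1 ≤ p.weight :=
  (Nat.succ_le_of_lt p.2.pos).trans (Nat.le_add_left _ _)

/-- The letter that encodes a form. -/
def enc (p : Form) : ℕ+ := ⟨Nat.pair (Encodable.encode p) p.weight + 1, Nat.succ_pos _⟩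

theorem enc_injective : Function.Injective enc := by
  intro p q h
  have h1 : Nat.pair (Encodable.encode p) p.weight = Nat.pair (Encodable.encode q) q.weight :=
    Nat.succ_injective (congrArg PNat.val h)
  exact Encodable.encode_injective (Nat.pair_eq_pair.1 h1).1

/-- This is why the weight is paired into the code: a form is bounded by `D ^ weight`, while
`PathData` requires a bound by a power whose exponent is the letter. -/
theorem weight_le_enc (p : Form) : p.weight ≤ (p.enc : ℕ) :=
  (Nat.right_le_pair _ _).trans (Nat.le_succ _)

/-- The form encoded by a letter. -/
noncomputable def dec : ℕ+ → Option Form := Function.partialInv enc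

theorem dec_eq_some {i : ℕ+} {p : Form} : dec i = some p ↔ enc p = i :=
  enc_injective.isPartialInv p i

theorem dec_enc (p : Form) : dec (enc p) = some p := dec_eq_some.2 rfl

end Form

/-- The sizes of the letters in terms of the weights of the forms they encode. -/
noncomputable def formSize (i : ℕ+) : ℕ := ((Form.dec i).map Form.weight).getD 1

theorem formSize_enc (p : Form) : formSize p.enc = p.weight := by
  simp [formSize, Form.dec_enc]

theorem one_le_formSize (i : ℕ+) : 1 ≤ formSize i := by
  unfold formSize
  cases Form.dec i with
  | none => exact le_rfl
  | some p => exact p.one_le_weight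

/-- All words obtained by inserting the letters of a list, one after the other, in a word from a
list of words. -/
def insertLetters (l : List ℕ+) (L : List (List ℕ+)) : List (List ℕ+) :=
  l.foldr (fun i L => L.flatMap (List.permutations'Aux i)) L

/-- The words (with multiplicities) whose iterated integrals add up to the iterated integral of the
forms encoded by the letters of a word. -/
noncomputable def expand : List ℕ+ → List (List ℕ+)
  | [] => [List.nil]
  | i :: W =>
    match Form.dec i with
    | none => []
    | some p => (insertLetters p.1.toList (expand W)).map (p.2 :: ·)

theorem expand_nil : expand [] = [List.nil] := by rw [expand]

theorem expand_cons_none {i : ℕ+} (h : Form.dec i = none) (W : List ℕ+) :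
    expand (i :: W) = [] := by
  rw [expand, h]

theorem expand_cons_some {i : ℕ+} {p : Form} (h : Form.dec i = some p) (W : List ℕ+) :
    expand (i :: W) = (insertLetters p.1.toList (expand W)).map (p.2 :: ·) := by
  rw [expand, h]

/-- The series of the iterated integrals of polynomial one-forms. -/
noncomputable def momentSeries (g : SeriesGroup) : SeriesGroup where
  coeff W := ((expand W).map g.coeff).sum
  coeff_nil := by simp [expand_nil, g.coeff_nil]

theorem coeff_momentSeries (g : SeriesGroup) (W : List ℕ+) :
    (momentSeries g).coeff W = ((expand W).map g.coeff).sum := rfl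

/-- Each moment is a finite sum of coefficients, which is why moments extend continuously to formal
paths. -/
theorem continuous_momentSeries : Continuous momentSeries := by
  refine continuous_induced_rng.2 (continuous_pi fun W => ?_)
  change Continuous fun g : SeriesGroup => ((expand W).map g.coeff).sum
  exact continuous_list_sum _ fun w _ => SeriesGroup.continuous_coeff w

instance : T2Space SeriesGroup :=
  T2Space.of_injective_continuous (f := SeriesGroup.coeff) (fun _ _ h => SeriesGroup.ext h)
    continuous_induced_dom

/-! ## The path of polynomial one-forms along a path -/

section Path

variable {T : ℝ}

/-- The value at `x` of the monomial `∏_{i ∈ μ} ã_i`. -/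
noncomputable def monomialEval (μ : Multiset ℕ+) (a : PathData T) (x : ℝ) : ℂ :=
  (μ.map fun i => ∫ s in (0 : ℝ)..x, a.toFun i s).prod

theorem monomialEval_zero (a : PathData T) (x : ℝ) : monomialEval 0 a x = 1 := by
  simp [monomialEval]

theorem monomialEval_cons (i : ℕ+) (μ : Multiset ℕ+) (a : PathData T) (x : ℝ) :
    monomialEval (i ::ₘ μ) a x = (∫ s in (0 : ℝ)..x, a.toFun i s) * monomialEval μ a x := by
  simp [monomialEval]

theorem monomialEval_add (μ ν : Multiset ℕ+) (a : PathData T) (x : ℝ) :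
    monomialEval (μ + ν) a x = monomialEval μ a x * monomialEval ν a x := by
  simp [monomialEval]

theorem iterInt_singleton (a : PathData T) (i : ℕ+) (x : ℝ) :
    iterInt ([i].map a.toFun) x = ∫ s in (0 : ℝ)..x, a.toFun i s := by
  simp [iterInt]

theorem isPrimitive_letter (a : PathData T) (hT : 0 ≤ T) (i : ℕ+) :
    IsPrimitive T (a.toFun i) fun x => ∫ s in (0 : ℝ)..x, a.toFun i s :=
  (isPrimitive_iterInt a hT i []).congr (fun x _ => by simp [iterInt])
    (fun x _ => (iterInt_singleton a i x).symm) hT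

/-- The Leibniz rule for a monomial; the multiset sum counts each variable with its multiplicity. -/
theorem isPrimitive_monomialEval (a : PathData T) (hT : 0 ≤ T) (μ : Multiset ℕ+) :
    IsPrimitive T (fun x => (μ.map fun j => monomialEval (μ.erase j) a x * a.toFun j x).sum)
      (monomialEval μ a) := by
  induction μ using Multiset.induction_on with
  | empty =>
    exact (IsPrimitive.const 1).congr (fun x _ => by simp) (fun x _ => monomialEval_zero a x) hT
  | cons i μ ih =>
    refine ((isPrimitive_letter a hT i).mul ih hT).congr (fun x _ => ?_)
      (fun x _ => monomialEval_cons i μ a x) hT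
    rw [Multiset.map_cons, Multiset.sum_cons, Multiset.erase_cons_head, mul_comm (a.toFun i x),
      ← Multiset.sum_map_mul_left]
    congr 2
    refine Multiset.map_congr rfl fun j hj => ?_
    rw [Multiset.erase_cons_tail_of_mem hj, monomialEval_cons, mul_assoc]

/-- The value at `x` of a form along a path. -/
noncomputable def Form.eval (p : Form) (a : PathData T) (x : ℝ) : ℂ :=
  monomialEval p.1 a x * a.toFun p.2 x

theorem Form.exists_norm_eval_le (a : PathData T) (hT : 0 ≤ T) :
    ∃ D : ℝ, 1 ≤ D ∧ ∀ p : Form, ∀ x ∈ Icc 0 T, ‖p.eval a x‖ ≤ D ^ p.weight := by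
  obtain ⟨C, hC0, hC⟩ := a.bounded
  -- Each factor `ã_i` is at most `T * C ^ i`. Enlarging both constants by `1` allows `T` to be
  -- replaced by a power with exponent `i`, and makes the base at least `1`.
  refine ⟨(T + 1) * (C + 1), by nlinarith, fun p x hx => ?_⟩
  have hT1 : ∀ i : ℕ+, T ≤ (T + 1) ^ (i : ℕ) := fun i =>
    (by linarith : T ≤ T + 1).trans (le_self_pow₀ (by linarith) i.ne_zero)
  have hC1 : ∀ i : ℕ+, C ^ (i : ℕ) ≤ (C + 1) ^ (i : ℕ) := fun i =>
    pow_le_pow_left₀ hC0 (by linarith) _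
  have hmon : ∀ μ : Multiset ℕ+, ‖monomialEval μ a x‖ ≤
      ((T + 1) * (C + 1)) ^ (μ.map fun i : ℕ+ => (i : ℕ)).sum := by
    intro μ
    induction μ using Multiset.induction_on with
    | empty => simp [monomialEval_zero]
    | cons i μ ih =>
      rw [monomialEval_cons, norm_mul, Multiset.map_cons, Multiset.sum_cons, pow_add]
      refine mul_le_mul ?_ ih (norm_nonneg _) (by positivity)
      refine (intervalIntegral.norm_integral_le_of_norm_le_const (C := C ^ (i : ℕ))
        fun s hs => ?_).trans ?_
      · rw [uIoc_of_le hx.1] at hs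
        exact hC i s ⟨hs.1.le, hs.2.trans hx.2⟩
      · rw [sub_zero, abs_of_nonneg hx.1, mul_pow, mul_comm]
        exact mul_le_mul (hx.2.trans (hT1 i)) (hC1 i) (by positivity) (by positivity)
  rw [Form.eval, norm_mul, Form.weight, pow_add]
  refine mul_le_mul (hmon _) ((hC p.2 x hx).trans ?_) (norm_nonneg _) (by positivity)
  refine (hC1 p.2).trans (pow_le_pow_left₀ (by linarith) ?_ _)
  nlinarith

/-- The value at `x` of the form encoded by a letter. -/
noncomputable def letterEval (a : PathData T) (i : ℕ+) (x : ℝ) : ℂ :=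
  ((Form.dec i).map fun p => p.eval a x).getD 0

theorem letterEval_none (a : PathData T) {i : ℕ+} (h : Form.dec i = none) (x : ℝ) :
    letterEval a i x = 0 := by
  simp [letterEval, h]

theorem letterEval_some (a : PathData T) {i : ℕ+} {p : Form} (h : Form.dec i = some p) (x : ℝ) :
    letterEval a i x = p.eval a x := by
  simp [letterEval, h]

theorem integral_letter_of_mem_closedPaths {a : PathData T} (ha : a ∈ closedPaths T) (i : ℕ+) :
    ∫ s in (0 : ℝ)..T, a.toFun i s = 0 := by
  rw [← iterInt_singleton, ← E_coeff]
  exact (mem_closedPaths_iff a).1 ha i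

variable [hT : Fact (0 < T)]

/-- The path whose coordinates are the polynomial one-forms along a path. -/
noncomputable def formPath (a : PathData T) : PathData T where
  -- Continuity of the monomials is known only on `[0, T]`; cutting off outside makes the functions
  -- measurable on the line.
  toFun i := (Icc 0 T).indicator (letterEval a i)
  measurable i := by
    cases h : Form.dec i with
    | none =>
      have : letterEval a i = fun _ => 0 := funext fun x => letterEval_none a h x
      rw [this, indicator_zero]
      exact measurable_const
    | some p =>
      have h1 : (Icc 0 T).indicator (letterEval a i) =
          fun x => (Icc 0 T).indicator (monomialEval p.1 a) x * a.toFun p.2 x := by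
        funext x
        by_cases hx : x ∈ Icc 0 T
        · simp [hx, letterEval_some a h, Form.eval]
        · simp [hx]
      have h2 : Measurable ((Icc 0 T).indicator (monomialEval p.1 a)) := by
        rw [← piecewise_eq_indicator]
        exact ((isPrimitive_monomialEval a hT.out.le p.1).continuousOn
          hT.out.le).measurable_piecewise continuousOn_const measurableSet_Icc
      rw [h1]
      exact h2.mul (a.measurable p.2)
  bounded := by
    obtain ⟨D, hD1, hD⟩ := Form.exists_norm_eval_le a hT.out.le
    refine ⟨D, by linarith, fun i x hx => ?_⟩
    rw [indicator_of_mem hx]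
    cases h : Form.dec i with
    | none => rw [letterEval_none a h, norm_zero]; positivity
    | some p =>
      rw [letterEval_some a h]
      refine (hD p x hx).trans (pow_le_pow_right₀ hD1 ?_)
      rw [← Form.dec_eq_some.1 h]
      exact p.weight_le_enc

theorem formPath_toFun (a : PathData T) (i : ℕ+) {x : ℝ} (hx : x ∈ Icc 0 T) :
    (formPath a).toFun i x = letterEval a i x := indicator_of_mem hx _

theorem formPath_enc (a : PathData T) (p : Form) {x : ℝ} (hx : x ∈ Icc 0 T) :
    (formPath a).toFun p.enc x = p.eval a x := by
  rw [formPath_toFun a _ hx, letterEval_some a p.dec_enc]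

theorem integral_multiset_sum {ι : Type*} (s : Multiset ι) (F : ι → ℝ → ℂ) {x : ℝ}
    (hF : ∀ i ∈ s, IntervalIntegrable (F i) volume 0 x) :
    IntervalIntegrable (fun t => (s.map fun i => F i t).sum) volume 0 x ∧
      ∫ t in (0 : ℝ)..x, (s.map fun i => F i t).sum =
        (s.map fun i => ∫ t in (0 : ℝ)..x, F i t).sum := by
  induction s using Multiset.induction_on with
  | empty => simp
  | cons i s ih =>
    have h1 := hF i (Multiset.mem_cons_self i s)
    have h2 := ih fun j hj => hF j (Multiset.mem_cons_of_mem hj)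
    simp only [Multiset.map_cons, Multiset.sum_cons]
    exact ⟨h1.add h2.1, by rw [intervalIntegral.integral_add h1 h2.1, h2.2]⟩

/-- One shuffle with a single letter for each factor of the monomial. -/
theorem monomialEval_mul_sum_iterInt (a : PathData T) (l : List ℕ+) (L : List (List ℕ+)) {x : ℝ}
    (hx : x ∈ Icc 0 T) :
    monomialEval (l : Multiset ℕ+) a x * (L.map fun w => iterInt (w.map a.toFun) x).sum =
      ((insertLetters l L).map fun w => iterInt (w.map a.toFun) x).sum := by
  induction l with
  | nil => simp [monomialEval_zero, insertLetters]
  | cons i l ih =>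
    rw [← Multiset.cons_coe, monomialEval_cons, mul_assoc, ih]
    change _ = (((insertLetters l L).flatMap (List.permutations'Aux i)).map _).sum
    simp only [← iterInt_singleton]
    generalize insertLetters l L = L'
    induction L' with
    | nil => simp
    | cons w L' ih' =>
      have h1 := iterInt_mul_iterInt a hT.out.le [i] w hx
      rw [shSum_singleton] at h1
      rw [List.flatMap_cons, List.map_append, List.sum_append, ← ih', ← h1, ← mul_add]
      rfl

/-- This justifies `expand`: in each form the coefficient monomial is absorbed into the inner
iterated integral by shuffling, and the differential is prepended as the outermost letter. -/
theorem iterInt_formPath (a : PathData T) (W : List ℕ+) {x : ℝ} (hx : x ∈ Icc 0 T) :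
    iterInt (W.map (formPath a).toFun) x =
      ((expand W).map fun w => iterInt (w.map a.toFun) x).sum := by
  induction W generalizing x with
  | nil => simp [expand_nil, iterInt]
  | cons i W ih =>
    have hmem : ∀ s ∈ uIcc 0 x, s ∈ Icc 0 T := fun s hs => by
      rw [uIcc_of_le hx.1] at hs; exact ⟨hs.1, hs.2.trans hx.2⟩
    change ∫ s in (0 : ℝ)..x, (formPath a).toFun i s * iterInt (W.map (formPath a).toFun) s = _
    cases h : Form.dec i with
    | none =>
      rw [expand_cons_none h, intervalIntegral.integral_congr (g := fun _ => 0)]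
      · simp
      · intro s hs
        simp [formPath_toFun a i (hmem s hs), letterEval_none a h]
    | some p =>
      have h1 := (integral_multiset_sum
        (insertLetters p.1.toList (expand W) : Multiset (List ℕ+))
        (fun w s => a.toFun p.2 s * iterInt (w.map a.toFun) s) (x := x)
        (fun w _ => integrable_iterInt a hT.out.le p.2 w (left_mem_Icc.2 hT.out.le) hx)).2
      simp only [Multiset.sum_map_mul_left] at h1
      simp only [Multiset.map_coe, Multiset.sum_coe] at h1
      rw [expand_cons_some h, List.map_map]
      refine Eq.trans (intervalIntegral.integral_congr fun s hs => ?_) h1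
      have h2 := monomialEval_mul_sum_iterInt a p.1.toList (expand W) (hmem s hs)
      rw [Multiset.coe_toList] at h2
      simp only [formPath_toFun a i (hmem s hs), letterEval_some a h, ih (hmem s hs), ← h2,
        Form.eval]
      ring

theorem momentSeries_E (a : PathData T) : momentSeries (E a) = E (formPath a) := by
  ext W
  rw [coeff_momentSeries, E_coeff, iterInt_formPath a W (right_mem_Icc.2 hT.out.le)]
  exact congrArg List.sum (List.map_congr_left fun w _ => E_coeff a w)

theorem monomialEval_mul_left (a b : PathData T) (μ : Multiset ℕ+) {x : ℝ} (hx : x ≤ T / 2) :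
    monomialEval μ (a * b) x = monomialEval μ b (2 * x) := by
  unfold monomialEval
  congr 1
  refine Multiset.map_congr rfl fun i _ => ?_
  rw [← iterInt_singleton, ← iterInt_singleton, iterInt_mul_left a b _ hx hT.out.le]

/-- Because `b` is closed, the primitives are back at `0` when `a` starts. The multiplicativity of
the moments rests on this. -/
theorem monomialEval_mul_right (a : PathData T) {b : PathData T} (hb : b ∈ closedPaths T)
    (μ : Multiset ℕ+) {x : ℝ} (hx : x ∈ Icc (T / 2) T) :
    monomialEval μ (a * b) x = monomialEval μ a (2 * x - T) := by
  unfold monomialEval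
  congr 1
  refine Multiset.map_congr rfl fun i _ => ?_
  rw [← iterInt_singleton, ← iterInt_singleton, iterInt_mul_right a b hT.out.le _ hx, conv_cons,
    conv_nil]
  rw [iterInt_singleton b, integral_letter_of_mem_closedPaths hb]
  simp [iterInt]

/-- On `[0, T]` the two paths `formPath (a * b)` and `formPath a * formPath b` agree pointwise. -/
theorem E_formPath_mul (a : PathData T) {b : PathData T} (hb : b ∈ closedPaths T) :
    E (formPath (a * b)) = E (formPath a) * E (formPath b) := by
  rw [← E_mul hT.out.le]
  ext W
  rw [E_coeff, E_coeff]
  refine iterInt_congr (T := T) (fun i x hx => ?_) W (right_mem_Icc.2 hT.out.le)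
  rw [formPath_toFun _ _ hx, PathData.mul_toFun]
  split_ifs with hx2
  · rw [formPath_toFun b i ⟨by linarith [hx.1], by linarith⟩]
    cases h : Form.dec i with
    | none => rw [letterEval_none _ h, letterEval_none _ h, mul_zero]
    | some p =>
      rw [letterEval_some _ h, letterEval_some _ h, Form.eval, Form.eval,
        monomialEval_mul_left a b _ hx2, PathData.mul_toFun, if_pos hx2]
      ring
  · rw [not_le] at hx2
    rw [formPath_toFun a i ⟨by linarith, by linarith [hx.2]⟩]
    cases h : Form.dec i with
    | none => rw [letterEval_none _ h, letterEval_none _ h, mul_zero]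
    | some p =>
      rw [letterEval_some _ h, letterEval_some _ h, Form.eval, Form.eval,
        monomialEval_mul_right a hb _ ⟨hx2.le, hx.2⟩, PathData.mul_toFun, if_neg (not_le.2 hx2)]
      ring

end Path

/-! ## Exact forms -/

/-- The product of a monomial and a form. -/
def Form.mulMonomial (β : Multiset ℕ+) (p : Form) : Form := (β + p.1, p.2)

theorem Form.weight_mulMonomial (β : Multiset ℕ+) (p : Form) :
    (p.mulMonomial β).weight = (β.map fun i : ℕ+ => (i : ℕ)).sum + p.weight := by
  simp [Form.mulMonomial, Form.weight, add_assoc]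

/-- The total weight of a word of forms. -/
def formsWeight (W : List Form) : ℕ := (W.map Form.weight).sum

theorem formsWeight_cons (p : Form) (W : List Form) :
    formsWeight (p :: W) = p.weight + formsWeight W := by simp [formsWeight]

theorem formsWeight_append (U V : List Form) :
    formsWeight (U ++ V) = formsWeight U + formsWeight V := by simp [formsWeight]

theorem wordSize_map_enc (W : List Form) :
    wordSize formSize (W.map Form.enc) = formsWeight W := by
  simp [wordSize, formsWeight, Function.comp_def, formSize_enc]

/-- The coefficient of the moment series at a word of forms. -/
noncomputable def formCoeff (g : SeriesGroup) (W : List Form) : ℂ :=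
  (momentSeries g).coeff (W.map Form.enc)

theorem continuous_formCoeff (W : List Form) : Continuous fun g => formCoeff g W :=
  (SeriesGroup.continuous_coeff _).comp continuous_momentSeries

/-- Multiply the last form of a word by a monomial. -/
def absorbLast (β : Multiset ℕ+) : List Form → List Form
  | [] => []
  | [q] => [q.mulMonomial β]
  | q :: r :: U => q :: absorbLast β (r :: U)

/-- Multiply the first form of a word by a monomial; there is no result if the word is empty. -/
def absorbHead (β : Multiset ℕ+) : List Form → List (List Form)
  | [] => []
  | q :: V => [q.mulMonomial β :: V]

theorem length_absorbLast (β : Multiset ℕ+) (U : List Form) :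
    (absorbLast β U).length = U.length := by
  induction U with
  | nil => rfl
  | cons q U ih =>
    cases U with
    | nil => rfl
    | cons r U => simpa [absorbLast] using ih

theorem formsWeight_absorbLast (β : Multiset ℕ+) {U : List Form} (hU : U ≠ []) :
    formsWeight (absorbLast β U) = (β.map fun i : ℕ+ => (i : ℕ)).sum + formsWeight U := by
  induction U with
  | nil => exact absurd rfl hU
  | cons q U ih =>
    cases U with
    | nil => simp [absorbLast, formsWeight, Form.weight_mulMonomial]
    | cons r U =>
      rw [absorbLast, formsWeight_cons, ih (by simp), formsWeight_cons q]
      ring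

section Path

variable {T : ℝ}

theorem monomialEval_zero_right (a : PathData T) {β : Multiset ℕ+} (hβ : β ≠ 0) :
    monomialEval β a 0 = 0 := by
  obtain ⟨i, hi⟩ := Multiset.exists_mem_of_ne_zero hβ
  obtain ⟨μ, rfl⟩ := Multiset.exists_cons_of_mem hi
  simp [monomialEval_cons]
variable [hT : Fact (0 < T)]

/-- The iterated integral of a word of forms. -/
noncomputable def formInt (a : PathData T) (W : List Form) (x : ℝ) : ℂ :=
  iterInt ((W.map Form.enc).map (formPath a).toFun) x

theorem formInt_cons (a : PathData T) (p : Form) (W : List Form) {x : ℝ} (hx : x ∈ Icc 0 T) :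
    formInt a (p :: W) x = ∫ s in (0 : ℝ)..x, p.eval a s * formInt a W s := by
  refine intervalIntegral.integral_congr fun s hs => ?_
  rw [uIcc_of_le hx.1] at hs
  simp only [formPath_enc a p (x := s) ⟨hs.1, hs.2.trans hx.2⟩]
  rfl

theorem isPrimitive_formInt_cons (a : PathData T) (p : Form) (W : List Form) :
    IsPrimitive T (fun s => p.eval a s * formInt a W s) (formInt a (p :: W)) :=
  (isPrimitive_iterInt (formPath a) hT.out.le p.enc (W.map Form.enc)).congr
    (fun x hx => by rw [formPath_enc a p hx]; rfl) (fun x _ => rfl) hT.out.le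

/-- Integration by parts: with `d(x^β)` outermost, the boundary term is the right-hand side, and the
remaining integral multiplies the next form by `x^β`. -/
theorem sum_formInt_exact_head (a : PathData T) {β : Multiset ℕ+} (hβ : β ≠ 0) (V : List Form)
    {x : ℝ} (hx : x ∈ Icc 0 T) :
    (β.map fun j => formInt a ((β.erase j, j) :: V) x).sum +
        ((absorbHead β V).map fun W => formInt a W x).sum =
      monomialEval β a x * formInt a V x := by
  have hx0 : (0 : ℝ) ∈ Icc 0 T := left_mem_Icc.2 hT.out.le
  have hm := isPrimitive_monomialEval a hT.out.le β
  have h1 : (β.map fun j => formInt a ((β.erase j, j) :: V) x).sum =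
      ∫ s in (0 : ℝ)..x, (β.map fun j => monomialEval (β.erase j) a s * a.toFun j s).sum *
        formInt a V s := by
    simp only [← Multiset.sum_map_mul_right]
    rw [(integral_multiset_sum β
      (fun j s => monomialEval (β.erase j) a s * a.toFun j s * formInt a V s) fun j _ =>
        (isPrimitive_formInt_cons a (β.erase j, j) V).intervalIntegrable hx0 hx).2]
    exact congrArg Multiset.sum (Multiset.map_congr rfl fun j _ => formInt_cons a _ V hx)
  rw [h1]
  cases V with
  | nil =>
    simp only [absorbHead, formInt, List.map_nil, iterInt, mul_one, List.sum_nil, add_zero]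
    exact (hm.eq_integral (monomialEval_zero_right a hβ) hx).symm
  | cons p V =>
    have hV := isPrimitive_formInt_cons a p V
    have h2 : ((absorbHead β (p :: V)).map fun W => formInt a W x).sum =
        ∫ s in (0 : ℝ)..x, monomialEval β a s * (p.eval a s * formInt a V s) := by
      simp only [absorbHead, List.map_cons, List.map_nil, List.sum_cons, List.sum_nil, add_zero]
      rw [formInt_cons a _ V hx]
      refine intervalIntegral.integral_congr fun s _ => ?_
      simp only [Form.eval, Form.mulMonomial, monomialEval_add]
      ring
    have hsub : uIcc 0 x ⊆ Icc 0 T := ordConnected_Icc.uIcc_subset hx0 hx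
    rw [h2, (hm.mul hV hT.out.le).eq_integral (by simp [monomialEval_zero_right a hβ]) hx,
      intervalIntegral.integral_add]
    · exact (hm.intervalIntegrable hx0 hx).mul_continuousOn
        ((hV.continuousOn hT.out.le).mono hsub)
    · simpa only [mul_comm] using (hV.intervalIntegrable hx0 hx).mul_continuousOn
        ((hm.continuousOn hT.out.le).mono hsub)

/-- The same integration by parts in an inner slot: the boundary term is now absorbed by the form
just outside, and integrating over further outer forms preserves the identity. -/
theorem sum_formInt_exact (a : PathData T) {β : Multiset ℕ+} (hβ : β ≠ 0) (q : Form)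
    (U V : List Form) {x : ℝ} (hx : x ∈ Icc 0 T) :
    (β.map fun j => formInt a (q :: U ++ (β.erase j, j) :: V) x).sum +
        ((absorbHead β V).map fun W => formInt a (q :: U ++ W) x).sum =
      formInt a (absorbLast β (q :: U) ++ V) x := by
  have hx0 : (0 : ℝ) ∈ Icc 0 T := left_mem_Icc.2 hT.out.le
  have key : ∀ U, ((β.map fun j => formInt a (q :: U ++ (β.erase j, j) :: V) x).sum +
        ((absorbHead β V).map fun W => formInt a (q :: U ++ W) x).sum) =
      ∫ s in (0 : ℝ)..x, q.eval a s * ((β.map fun j => formInt a (U ++ (β.erase j, j) :: V) s).sum +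
        ((absorbHead β V).map fun W => formInt a (U ++ W) s).sum) := by
    intro U
    have h1 := integral_multiset_sum (x := x) β
      (fun j s => q.eval a s * formInt a (U ++ (β.erase j, j) :: V) s) fun j _ =>
        (isPrimitive_formInt_cons a q _).intervalIntegrable hx0 hx
    have h2 := integral_multiset_sum (x := x) (absorbHead β V : Multiset (List Form))
      (fun W s => q.eval a s * formInt a (U ++ W) s) fun W _ =>
        (isPrimitive_formInt_cons a q _).intervalIntegrable hx0 hx
    simp only [Multiset.map_coe, Multiset.sum_coe, Multiset.sum_map_mul_left,
      List.sum_map_mul_left] at h1 h2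
    simp only [mul_add]
    rw [intervalIntegral.integral_add h1.1 h2.1, h1.2, h2.2]
    simp only [← formInt_cons a q _ hx, List.cons_append]
  rw [key]
  cases U with
  | nil =>
    rw [absorbLast, List.singleton_append, formInt_cons a _ V hx]
    refine intervalIntegral.integral_congr fun s hs => ?_
    have hs' : s ∈ Icc 0 T := ordConnected_Icc.uIcc_subset hx0 hx hs
    simp only [List.nil_append, sum_formInt_exact_head a hβ V hs', Form.eval, Form.mulMonomial,
      monomialEval_add]
    ring
  | cons r U =>
    rw [absorbLast, List.cons_append, formInt_cons a _ _ hx]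
    refine intervalIntegral.integral_congr fun s hs => ?_
    have hs' : s ∈ Icc 0 T := ordConnected_Icc.uIcc_subset hx0 hx hs
    simp only [sum_formInt_exact a hβ r U V hs']
termination_by U.length

theorem formCoeff_E (a : PathData T) (W : List Form) : formCoeff (E a) W = formInt a W T := by
  rw [formCoeff, momentSeries_E, E_coeff, formInt]

end Path

/-! ## Identities on the group of formal closed paths -/

section Closed

variable {T : ℝ} [hT : Fact (0 < T)]

theorem formalClosedPathGroup_induction {p : SeriesGroup → Prop} (hc : IsClosed {g | p g})
    (h : ∀ a ∈ closedPaths T, p (E a)) {g : SeriesGroup} (hg : g ∈ formalClosedPathGroup T) :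
    p g := by
  refine closure_minimal (s := (closedPathGroup T : Set SeriesGroup)) ?_ hc hg
  rintro _ ⟨a, ha, rfl⟩
  exact h a ha

theorem continuous_multiset_sum_map {X ι : Type*} [TopologicalSpace X] (s : Multiset ι)
    (F : ι → X → ℂ) (hF : ∀ i, Continuous (F i)) :
    Continuous fun x => (s.map fun i => F i x).sum :=
  continuous_multiset_sum _ fun i _ => hF i

/-- The relation between the iterated integrals along closed paths that comes from an exact form in
a word of forms. -/
theorem sum_formCoeff_exact {g : SeriesGroup} (hg : g ∈ formalClosedPathGroup T)
    {β : Multiset ℕ+} (hβ : β ≠ 0) (U V : List Form) :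
    (β.map fun j => formCoeff g (U ++ (β.erase j, j) :: V)).sum +
        ((absorbHead β V).map fun W => formCoeff g (U ++ W)).sum =
      if U = [] then 0 else formCoeff g (absorbLast β U ++ V) := by
  refine formalClosedPathGroup_induction (p := fun g =>
    (β.map fun j => formCoeff g (U ++ (β.erase j, j) :: V)).sum +
        ((absorbHead β V).map fun W => formCoeff g (U ++ W)).sum =
      if U = [] then 0 else formCoeff g (absorbLast β U ++ V)) ?_ (fun a ha => ?_) hg
  · refine isClosed_eq ((continuous_multiset_sum_map _ _ fun j => continuous_formCoeff _).add
      (continuous_list_sum _ fun W _ => continuous_formCoeff _)) ?_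
    split_ifs
    exacts [continuous_const, continuous_formCoeff _]
  · have hTmem : T ∈ Icc 0 T := right_mem_Icc.2 hT.out.le
    simp only [formCoeff_E]
    cases U with
    | nil =>
      rw [if_pos rfl]
      simp only [List.nil_append]
      rw [sum_formInt_exact_head a hβ V hTmem]
      obtain ⟨i, hi⟩ := Multiset.exists_mem_of_ne_zero hβ
      obtain ⟨μ, rfl⟩ := Multiset.exists_cons_of_mem hi
      rw [monomialEval_cons, integral_letter_of_mem_closedPaths ha]
      simp
    | cons q U =>
      rw [if_neg (by simp)]
      exact sum_formInt_exact a hβ q U V hTmem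

/-- If all shorter words of forms of the same weight have zero coefficient, then the terms of length
`m` of the moment series kill exact forms. -/
theorem sum_formCoeff_exact_eq_zero {g : SeriesGroup} (hg : g ∈ formalClosedPathGroup T)
    {β : Multiset ℕ+} (hβ : β ≠ 0) (U V : List Form)
    (hz : ∀ W : List Form, W ≠ [] → W.length = U.length + V.length →
      formsWeight W = formsWeight U + (β.map fun i : ℕ+ => (i : ℕ)).sum + formsWeight V →
      formCoeff g W = 0) :
    (β.map fun j => formCoeff g (U ++ (β.erase j, j) :: V)).sum = 0 := by
  have h := sum_formCoeff_exact hg hβ U V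
  have h1 : ((absorbHead β V).map fun W => formCoeff g (U ++ W)).sum = 0 := by
    cases V with
    | nil => simp [absorbHead]
    | cons p V =>
      simp only [absorbHead, List.map_cons, List.map_nil, List.sum_cons, List.sum_nil, add_zero]
      refine hz _ (by simp) (by simp) ?_
      simp only [formsWeight_append, formsWeight_cons, Form.weight_mulMonomial]
      ring
  have h2 : (if U = [] then 0 else formCoeff g (absorbLast β U ++ V)) = 0 := by
    split_ifs with hU
    · rfl
    · refine hz _ ?_ (by simp [length_absorbLast]) ?_
      · rw [← List.length_pos_iff, List.length_append, length_absorbLast]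
        have := List.length_pos_iff.2 hU
        omega
      · rw [formsWeight_append, formsWeight_absorbLast β hU]
        ring
  rw [h1, add_zero, h2] at h
  exact h

theorem continuous_shSum {X α : Type*} [TopologicalSpace X] (F : X → List α → ℂ)
    (hF : ∀ z, Continuous fun x => F x z) (u v : List α) :
    Continuous fun x => shSum (F x) u v := by
  induction hn : u.length + v.length using Nat.strong_induction_on generalizing F u v with
  | _ n ih =>
    subst hn
    cases u with
    | nil => simpa only [shSum_nil_left] using hF v
    | cons c u =>
      cases v with
      | nil => simpa only [shSum_nil_right] using hF _
      | cons d v =>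
        simp only [shSum_cons_cons]
        exact (ih _ (by simp) (fun x z => F x (c :: z)) (fun z => hF _) _ _ rfl).add
          (ih _ (by simp) (fun x z => F x (d :: z)) (fun z => hF _) _ _ rfl)

theorem coeff_E_mul_coeff_E (a : PathData T) (u v : List ℕ+) :
    (E a).coeff u * (E a).coeff v = shSum (E a).coeff u v := by
  have h : (E a).coeff = fun w => iterInt (w.map a.toFun) T := funext (E_coeff a)
  rw [h]
  exact iterInt_mul_iterInt a hT.out.le u v (right_mem_Icc.2 hT.out.le)

/-- For a genuine path the moment series is again some `E`, whose coefficients satisfy the shuffle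
relations; closedness passes them to the limit. -/
theorem momentSeries_shuffle {g : SeriesGroup} (hg : g ∈ formalClosedPathGroup T) (u v : List ℕ+) :
    (momentSeries g).coeff u * (momentSeries g).coeff v = shSum (momentSeries g).coeff u v := by
  have hc : ∀ w, Continuous fun g => (momentSeries g).coeff w := fun w =>
    (SeriesGroup.continuous_coeff w).comp continuous_momentSeries
  refine formalClosedPathGroup_induction (p := fun g => (momentSeries g).coeff u *
    (momentSeries g).coeff v = shSum (momentSeries g).coeff u v) ?_ (fun a _ => ?_) hg
  · exact isClosed_eq ((hc u).mul (hc v))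
      (continuous_shSum (fun g => (momentSeries g).coeff) hc u v)
  · rw [momentSeries_E]
    exact coeff_E_mul_coeff_E _ u v

/-- The identity is known for genuine closed paths and extends by density, one variable at a time.
-/
theorem momentSeries_mul {g h : SeriesGroup} (hg : g ∈ formalClosedPathGroup T)
    (hh : h ∈ formalClosedPathGroup T) :
    momentSeries (g * h) = momentSeries g * momentSeries h := by
  refine formalClosedPathGroup_induction
    (p := fun h => momentSeries (g * h) = momentSeries g * momentSeries h) ?_ (fun b hb => ?_) hh
  · exact isClosed_eq (continuous_momentSeries.comp (continuous_const.mul continuous_id))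
      (continuous_const.mul continuous_momentSeries)
  refine formalClosedPathGroup_induction
    (p := fun g => momentSeries (g * E b) = momentSeries g * momentSeries (E b)) ?_
    (fun a _ => ?_) hg
  · exact isClosed_eq (continuous_momentSeries.comp (continuous_id.mul continuous_const))
      (continuous_momentSeries.mul continuous_const)
  · rw [← E_mul hT.out.le, momentSeries_E, momentSeries_E, momentSeries_E, E_formPath_mul a hb]

variable (T) in
/-- The moment series as a homomorphism on the group of formal closed paths. -/
noncomputable def momentHom : formalClosedPathGroup T →* SeriesGroup :=
  MonoidHom.mk' (fun g => momentSeries (g : SeriesGroup)) fun g h => by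
    rw [Subgroup.coe_mul]; exact momentSeries_mul g.2 h.2

theorem momentHom_apply (g : formalClosedPathGroup T) : momentHom T g = momentSeries g := rfl

theorem momentSeries_commutator {g h : SeriesGroup} (hg : g ∈ formalClosedPathGroup T)
    (hh : h ∈ formalClosedPathGroup T) :
    momentSeries ⁅g, h⁆ = ⁅momentSeries g, momentSeries h⁆ := by
  have h1 := map_commutatorElement (momentHom T) ⟨g, hg⟩ ⟨h, hh⟩
  simp only [momentHom_apply, commutatorElement_def, Subgroup.coe_mul, Subgroup.coe_inv] at h1 ⊢
  exact h1

end Closed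

/-! ## Weights of the words in the expansion of a word of forms -/

section Weights

theorem wordSize_of_mem_insertLetters (σ : ℕ+ → ℕ) (l : List ℕ+) (L : List (List ℕ+)) {w : List ℕ+}
    (hw : w ∈ insertLetters l L) : ∃ v ∈ L, wordSize σ w = (l.map σ).sum + wordSize σ v := by
  induction l generalizing w with
  | nil => exact ⟨w, hw, by simp⟩
  | cons i l ih =>
    obtain ⟨u, hu, hw⟩ := List.mem_flatMap.1
      (show w ∈ (insertLetters l L).flatMap (List.permutations'Aux i) from hw)
    obtain ⟨v, hv, h⟩ := ih hu
    refine ⟨v, hv, ?_⟩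
    have hperm : w.Perm (i :: u) := by
      have h1 : w ∈ (i :: u).permutations' := by
        rw [List.permutations', List.mem_flatMap]
        exact ⟨u, List.mem_permutations'.2 (List.Perm.refl u), hw⟩
      exact List.mem_permutations'.1 h1
    have h2 : wordSize σ w = wordSize σ (i :: u) := (hperm.map σ).sum_eq
    rw [h2, wordSize_cons, h, List.map_cons, List.sum_cons, add_assoc]

/-- The size of a word in terms of the weights of its letters. -/
abbrev letterWeight (i : ℕ+) : ℕ := i

theorem one_le_letterWeight (i : ℕ+) : 1 ≤ letterWeight i := i.2

/-- Expanding a form preserves the weight, so `momentSeries` respects the weight filtrations. -/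
theorem wordSize_of_mem_expand (W : List ℕ+) {w : List ℕ+} (hw : w ∈ expand W) :
    wordSize letterWeight w = wordSize formSize W := by
  induction W generalizing w with
  | nil => simp only [expand_nil, List.mem_singleton] at hw; subst hw; rfl
  | cons i W ih =>
    cases h : Form.dec i with
    | none => rw [expand_cons_none h] at hw; simp at hw
    | some p =>
      rw [expand_cons_some h, List.mem_map] at hw
      obtain ⟨u, hu, rfl⟩ := hw
      obtain ⟨v, hv, h1⟩ := wordSize_of_mem_insertLetters letterWeight _ _ hu
      have h2 : (p.1.toList.map letterWeight).sum = (p.1.map fun i : ℕ+ => (i : ℕ)).sum := by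
        conv_rhs => rw [← Multiset.coe_toList p.1]
        rw [Multiset.map_coe, Multiset.sum_coe]
      rw [wordSize_cons, wordSize_cons, h1, ih hv, h2, ← Form.dec_eq_some.1 h, formSize_enc,
        Form.weight]
      ring

theorem momentSeries_mem_filt {g : SeriesGroup} {d : ℕ} (hg : g ∈ filt letterWeight d) :
    momentSeries g ∈ filt formSize d := by
  intro W hW hd
  rw [coeff_momentSeries]
  refine List.sum_eq_zero fun x hx => ?_
  obtain ⟨w, hw, rfl⟩ := List.mem_map.1 hx
  have h := wordSize_of_mem_expand W hw
  refine hg w ?_ (h ▸ hd)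
  rintro rfl
  have := wordSize_pos one_le_formSize hW
  rw [wordSize_nil] at h
  omega

/-- The form `dx_i`. -/
def Form.single (i : ℕ+) : Form := (0, i)

theorem expand_single (w : List ℕ+) : expand (w.map fun i => (Form.single i).enc) = [w] := by
  induction w with
  | nil => exact expand_nil
  | cons i w ih =>
    rw [List.map_cons, expand_cons_some (Form.dec_enc _), ih]
    simp [Form.single, insertLetters]

/-- The basic iterated integrals are moments of the forms `dx_i`. Hence a series whose moments of
weight `d` all vanish has no terms of weight `d`. -/
theorem coeff_eq_formCoeff (g : SeriesGroup) (w : List ℕ+) :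
    g.coeff w = formCoeff g (w.map Form.single) := by
  rw [formCoeff, List.map_map, coeff_momentSeries]
  erw [expand_single]
  simp

theorem formsWeight_single (w : List ℕ+) :
    formsWeight (w.map Form.single) = wordSize letterWeight w := by
  simp [formsWeight, wordSize, Function.comp_def, Form.weight, Form.single]

/-- Words containing a letter that encodes no form have an empty expansion and need no check. -/
theorem momentSeries_coeff_eq_zero_of_formCoeff {g : SeriesGroup} {W : List ℕ+}
    (h : ∀ V : List Form, V.map Form.enc = W → formCoeff g V = 0) :
    (momentSeries g).coeff W = 0 := by
  by_cases hV : ∃ V : List Form, V.map Form.enc = W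
  · obtain ⟨V, rfl⟩ := hV
    exact h V rfl
  · have : expand W = [] := by
      clear h
      induction W with
      | nil => exact absurd ⟨[], rfl⟩ hV
      | cons i W ih =>
        cases h : Form.dec i with
        | none => exact expand_cons_none h W
        | some p =>
          rw [expand_cons_some h, ih]
          · have : ∀ l, insertLetters l [] = [] := fun l => by
              induction l with
              | nil => rfl
              | cons i l ih =>
                change (insertLetters l []).flatMap _ = _
                rw [ih, List.flatMap_nil]
            rw [this, List.map_nil]
          · rintro ⟨V, rfl⟩
            exact hV ⟨p :: V, by rw [List.map_cons, Form.dec_eq_some.1 h]⟩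
    rw [coeff_momentSeries, this]
    simp

end Weights

/-! ## Sums over all arrangements of a multiset of letters -/

section Arrangements

/-- The sum of the values of a function over all arrangements of a list. -/
def permSum (F : List ℕ+ → ℂ) (l : List ℕ+) : ℂ := (l.permutations'.map F).sum

theorem permSum_nil (F : List ℕ+ → ℂ) : permSum F [] = F [] := by
  simp [permSum]

/-- The sum of the values of a function over all insertions of a letter in a word. -/
def insSum (i : ℕ+) (F : List ℕ+ → ℂ) (w : List ℕ+) : ℂ :=
  ((List.permutations'Aux i w).map F).sum

theorem permSum_cons (F : List ℕ+ → ℂ) (i : ℕ+) (l : List ℕ+) :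
    permSum F (i :: l) = permSum (insSum i F) l := by
  rw [permSum, permSum, List.permutations']
  generalize l.permutations' = L
  induction L with
  | nil => rfl
  | cons w L ih => rw [List.flatMap_cons, List.map_append, List.sum_append, ih]; simp [insSum]

theorem permSum_perm (F : List ℕ+ → ℂ) {l l' : List ℕ+} (h : l.Perm l') :
    permSum F l = permSum F l' :=
  (h.permutations'.map F).sum_eq

theorem permSum_congr {F G : List ℕ+ → ℂ} {l : List ℕ+} (h : ∀ w, w.Perm l → F w = G w) :
    permSum F l = permSum G l :=
  congrArg List.sum (List.map_congr_left fun w hw => h w (List.mem_permutations'.1 hw))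

theorem permSum_add (F G : List ℕ+ → ℂ) (l : List ℕ+) :
    permSum (fun w => F w + G w) l = permSum F l + permSum G l := by
  rw [permSum, permSum, permSum, ← List.sum_map_add]

theorem permSum_mul_left (c : ℂ) (F : List ℕ+ → ℂ) (l : List ℕ+) :
    permSum (fun w => c * F w) l = c * permSum F l := by
  rw [permSum, permSum, ← List.sum_map_mul_left]

theorem permSum_sub (F G : List ℕ+ → ℂ) (l : List ℕ+) :
    permSum (fun w => F w - G w) l = permSum F l - permSum G l := by
  have h := permSum_add F (fun w => -1 * G w) l
  rw [permSum_mul_left] at h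
  simpa [sub_eq_add_neg] using h

theorem permSum_eq_zero {F : List ℕ+ → ℂ} {l : List ℕ+} (h : ∀ w, w.Perm l → F w = 0) :
    permSum F l = 0 :=
  List.sum_eq_zero fun x hx => by
    obtain ⟨w, hw, rfl⟩ := List.mem_map.1 hx
    exact h w (List.mem_permutations'.1 hw)

/-- Extension of a function on words by zero to the words with last letter `i`. -/
def lastFun (i : ℕ+) (F : List ℕ+ → ℂ) (w : List ℕ+) : ℂ :=
  if w.getLast? = some i then F w.dropLast else 0

theorem lastFun_nil (i : ℕ+) (F : List ℕ+ → ℂ) : lastFun i F [] = 0 := by simp [lastFun]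

theorem lastFun_cons (i : ℕ+) (F : List ℕ+ → ℂ) (y : ℕ+) {w : List ℕ+} (hw : w ≠ []) :
    lastFun i F (y :: w) = lastFun i (fun z => F (y :: z)) w := by
  obtain ⟨z, w, rfl⟩ := List.exists_cons_of_ne_nil hw
  simp [lastFun]

/-- The inserted letter lands either at the very end, where it must be `i`, or before a last letter
already equal to `i`. -/
theorem insSum_lastFun (i a : ℕ+) (F : List ℕ+ → ℂ) (w : List ℕ+) :
    insSum a (lastFun i F) w = (if a = i then F w else 0) + lastFun i (insSum a F) w := by
  induction w generalizing F with
  | nil => simp [insSum, lastFun]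
  | cons y w ih =>
    have h1 : insSum a (lastFun i F) (y :: w) =
        lastFun i F (a :: y :: w) + insSum a (lastFun i fun z => F (y :: z)) w := by
      simp only [insSum, List.permutations'Aux, List.map_cons, List.sum_cons, List.map_map]
      congr 2
      refine List.map_congr_left fun u hu => lastFun_cons i F y ?_
      rintro rfl
      cases w <;> simp [List.permutations'Aux] at hu
    rw [h1, ih, lastFun_cons i F a (by simp)]
    rcases eq_or_ne w [] with rfl | hw
    · simp [lastFun, insSum]
      ring
    · rw [lastFun_cons i _ y hw, lastFun_cons i _ y hw]
      simp only [lastFun, insSum, List.permutations'Aux, List.map_cons, List.sum_cons, List.map_map,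
        Function.comp_def]
      split_ifs <;> ring

/-- Arrangements are counted with multiplicity, so each of the copies of `i` in `l` can serve as the
last letter. This is the source of the derivative-like factor in
`IsLetterLike.formCoeff_commutator`. -/
theorem permSum_lastFun (i : ℕ+) (F : List ℕ+ → ℂ) (l : List ℕ+) :
    permSum (lastFun i F) l = l.count i * permSum F (l.erase i) := by
  induction l generalizing F with
  | nil => simp [permSum_nil, lastFun_nil]
  | cons a l ih =>
    rw [permSum_cons, permSum_congr fun w _ => insSum_lastFun i a F w, permSum_add, ih]
    by_cases ha : a = i
    · subst ha
      simp only [if_true, List.count_cons_self, List.erase_cons_head]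
      by_cases hl : a ∈ l
      · rw [← permSum_cons, permSum_perm F (List.perm_cons_erase hl).symm]
        push_cast
        ring
      · rw [List.count_eq_zero_of_not_mem hl]
        simp
    · simp only [if_neg ha]
      rw [List.count_cons_of_ne ha, List.erase_cons_tail (by simpa using ha), ← permSum_cons]
      simp [permSum]

theorem insertLetters_singleton_nil (l : List ℕ+) :
    insertLetters l [List.nil] = l.permutations' := by
  induction l with
  | nil => rfl
  | cons i l ih => rw [List.permutations', ← ih]; rfl

/-- A product of primitives is the sum of the iterated integrals over all arrangements of its
letters. -/
theorem formCoeff_singleton (g : SeriesGroup) (p : Form) :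
    formCoeff g [p] = permSum (fun w => g.coeff (p.2 :: w)) p.1.toList := by
  rw [formCoeff, List.map_cons, List.map_nil, coeff_momentSeries,
    expand_cons_some (Form.dec_enc p), expand_nil, insertLetters_singleton_nil, List.map_map]
  rfl

theorem wordSize_perm (σ : ℕ+ → ℕ) {u v : List ℕ+} (h : u.Perm v) : wordSize σ u = wordSize σ v :=
  (h.map σ).sum_eq

/-- The weight of a monomial. -/
abbrev monomialWeight (μ : Multiset ℕ+) : ℕ := (μ.map fun i : ℕ+ => (i : ℕ)).sum

theorem wordSize_toList (μ : Multiset ℕ+) : wordSize letterWeight μ.toList = monomialWeight μ := by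
  conv_rhs => rw [monomialWeight, ← Multiset.coe_toList μ]
  rw [Multiset.map_coe, Multiset.sum_coe]
  rfl

end Arrangements

/-! ## Leading terms of commutators with one-letter paths -/

section Leading

/-- The lowest term of the series `u` is `s X_i`. -/
structure IsLetterLike (i : ℕ+) (s : ℂ) (u : SeriesGroup) : Prop where
  mem_filt : u ∈ filt letterWeight i
  coeff_singleton : u.coeff [i] = s
  coeff_eq_zero : ∀ w, wordSize letterWeight w = i → w ≠ [i] → u.coeff w = 0

/-- By weight, only a cut with first piece of weight exactly `i` can contribute, and there `u` sees
only the word `[i]`. -/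
theorem IsLetterLike.mid_left {i : ℕ+} {s : ℂ} {u y : SeriesGroup} (hu : IsLetterLike i s u) {e : ℕ}
    (he : 1 ≤ e) (hy : y ∈ filt letterWeight e) {w : List ℕ+}
    (hw : wordSize letterWeight w = i + e) :
    mid u y w = if w.head? = some i then s * y.coeff w.tail else 0 := by
  have h0 : ∀ k ∈ Finset.Ico 1 w.length, ¬(k = 1 ∧ w.head? = some i) →
      u.coeff (w.take k) * y.coeff (w.drop k) = 0 := by
    intro k hk hne
    rw [Finset.mem_Ico] at hk
    have h1 := wordSize_take_add_drop letterWeight w k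
    have ht : w.take k ≠ [] := by rw [← List.length_pos_iff, List.length_take]; omega
    have hd : w.drop k ≠ [] := by rw [← List.length_pos_iff, List.length_drop]; omega
    rcases lt_trichotomy (wordSize letterWeight (w.take k)) i with h | h | h
    · rw [hu.mem_filt _ ht h, zero_mul]
    · rw [hu.coeff_eq_zero _ h, zero_mul]
      intro h2
      refine hne ⟨?_, ?_⟩
      · have := congrArg List.length h2
        rw [List.length_take] at this
        simp at this
        omega
      · cases w with
        | nil => simp at ht
        | cons x w =>
          obtain ⟨k, rfl⟩ : ∃ k', k = k' + 1 := ⟨k - 1, by omega⟩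
          rw [List.take_succ_cons, List.cons.injEq] at h2
          simp [h2.1]
    · rw [hy _ hd (by omega), mul_zero]
  split_ifs with h
  · cases w with
    | nil => simp at h
    | cons x w =>
      obtain rfl : x = i := by simpa using h
      have hwn : w ≠ [] := by
        rintro rfl
        simp [wordSize] at hw
        omega
      have hl := List.length_pos_iff.2 hwn
      rw [mid, Finset.sum_eq_single_of_mem 1 (by simp; omega)
        fun k hk hk1 => h0 k hk fun hc => hk1 hc.1]
      simp [hu.coeff_singleton]
  · exact Finset.sum_eq_zero fun k hk => h0 k hk fun hc => h hc.2

theorem IsLetterLike.mid_right {i : ℕ+} {s : ℂ} {u y : SeriesGroup} (hu : IsLetterLike i s u)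
    {e : ℕ} (he : 1 ≤ e) (hy : y ∈ filt letterWeight e) {w : List ℕ+}
    (hw : wordSize letterWeight w = i + e) :
    mid y u w = lastFun i (fun z => s * y.coeff z) w := by
  obtain ⟨v, x, rfl⟩ := List.eq_nil_or_concat w |>.resolve_left (by
    rintro rfl
    rw [wordSize_nil] at hw
    omega)
  rw [List.concat_eq_append] at *
  rw [wordSize_append, wordSize_cons, wordSize_nil, add_zero] at hw
  have hlt : ∀ k ∈ Finset.Ico 1 (v ++ [x]).length, ¬(k = v.length ∧ x = i) →
      y.coeff ((v ++ [x]).take k) * u.coeff ((v ++ [x]).drop k) = 0 := by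
    intro k hk hne
    rw [Finset.mem_Ico, List.length_append, List.length_singleton] at hk
    have h1 := wordSize_take_add_drop letterWeight (v ++ [x]) k
    rw [wordSize_append, wordSize_cons, wordSize_nil, add_zero, hw] at h1
    have ht : (v ++ [x]).take k ≠ [] := by
      rw [← List.length_pos_iff, List.length_take, List.length_append, List.length_singleton]; omega
    have hd : (v ++ [x]).drop k ≠ [] := by
      rw [← List.length_pos_iff, List.length_drop, List.length_append, List.length_singleton]; omega
    rcases lt_trichotomy (wordSize letterWeight ((v ++ [x]).drop k)) i with h | h | h
    · rw [hu.mem_filt _ hd h, mul_zero]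
    · rw [hu.coeff_eq_zero _ h, mul_zero]
      intro h2
      rw [List.drop_append_of_le_length (by omega)] at h2
      have hl := congrArg List.length h2
      simp only [List.length_append, List.length_drop, List.length_singleton] at hl
      have hk' : k = v.length := by omega
      rw [List.drop_eq_nil_of_le (by omega)] at h2
      exact hne ⟨hk', by simpa using h2⟩
    · rw [hy _ ht (by omega), zero_mul]
  rw [lastFun, List.getLast?_concat, List.dropLast_concat]
  by_cases hx : x = i
  · subst hx
    have hv : v ≠ [] := by
      rintro rfl
      rw [wordSize_nil] at hw
      simp [letterWeight] at hw
      omega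
    have hl := List.length_pos_iff.2 hv
    rw [mid, Finset.sum_eq_single_of_mem v.length (by simp; omega)
      fun k hk hk1 => hlt k hk fun hc => hk1 hc.1]
    simp [hu.coeff_singleton, mul_comm]
  · rw [if_neg (by simpa using hx)]
    exact Finset.sum_eq_zero fun k hk => hlt k hk fun hc => hx hc.2

/-- At leading weight the commutator is the bracket of `s X_i` with `y`. In the first product `i` is
the first letter, which is the differential; in the second it is the last letter and is removed from
the monomial `μ`. -/
theorem IsLetterLike.formCoeff_commutator {i : ℕ+} {s : ℂ} {u y : SeriesGroup}
    (hu : IsLetterLike i s u) {e : ℕ} (he : 1 ≤ e) (hy : y ∈ filt letterWeight e) {μ : Multiset ℕ+}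
    {j : ℕ+} (hw : monomialWeight μ + j = i + e) :
    formCoeff ⁅u, y⁆ [(μ, j)] =
      s * ((if j = i then permSum y.coeff μ.toList else 0) -
        μ.count i * formCoeff y [(μ.erase i, j)]) := by
  have h1 : ∀ w : List ℕ+, w.Perm μ.toList → ⁅u, y⁆.coeff (j :: w) =
      (if j = i then s else 0) * y.coeff w - s * lastFun i (fun z => y.coeff (j :: z)) w := by
    intro w hwp
    have hsz : wordSize letterWeight (j :: w) = i + e := by
      rw [wordSize_cons, wordSize_perm _ hwp, wordSize_toList]
      change (j : ℕ) + _ = _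
      omega
    rw [coeff_commutator one_le_letterWeight hu.mem_filt hy (by simp) hsz,
      hu.mid_left he hy hsz, hu.mid_right he hy hsz]
    congr 1
    · by_cases hj : j = i <;> simp [hj]
    · rcases eq_or_ne w [] with rfl | hwn
      · have hj : j ≠ i := by
          rintro rfl
          rw [wordSize_cons, wordSize_nil] at hsz
          simp [letterWeight] at hsz
          omega
        simp [lastFun, hj]
      · rw [lastFun_cons i _ j hwn]
        simp only [lastFun, mul_ite, mul_zero]
  rw [formCoeff_singleton, permSum_congr h1, permSum_sub, permSum_mul_left, permSum_mul_left,
    permSum_lastFun, formCoeff_singleton]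
  have h2 : (μ.toList.erase i).Perm (μ.erase i).toList := by
    rw [← Multiset.coe_eq_coe, Multiset.coe_toList, ← Multiset.coe_erase, Multiset.coe_toList]
  have h3 : μ.toList.count i = μ.count i := by
    rw [← Multiset.coe_count, Multiset.coe_toList]
  rw [permSum_perm _ h2, h3]
  split_ifs <;> ring

theorem IsLetterLike.permSum_coeff {i : ℕ+} {s : ℂ} {u : SeriesGroup} (hu : IsLetterLike i s u)
    {μ : Multiset ℕ+} (hμ : monomialWeight μ = i) :
    permSum u.coeff μ.toList = if μ = {i} then s else 0 := by
  split_ifs with h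
  · subst h
    simp [permSum, hu.coeff_singleton]
  · refine permSum_eq_zero fun w hw => hu.coeff_eq_zero w ?_ ?_
    · rw [wordSize_perm _ hw, wordSize_toList, hμ]
    · rintro rfl
      refine h ?_
      rw [← Multiset.coe_toList μ, ← Multiset.coe_eq_coe.2 hw]
      rfl

theorem IsLetterLike.formCoeff_singleton {i : ℕ+} {s : ℂ} {u : SeriesGroup}
    (hu : IsLetterLike i s u) {p : Form} (hp : p.weight = i) :
    formCoeff u [p] = if p = (0, i) then s else 0 := by
  rw [FormalPaths.formCoeff_singleton]
  split_ifs with h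
  · subst h
    simp [permSum, hu.coeff_singleton]
  · refine permSum_eq_zero fun w hw => hu.coeff_eq_zero _ ?_ ?_
    · rw [wordSize_cons, wordSize_perm _ hw, wordSize_toList, ← hp, Form.weight, add_comm]
    · intro h1
      rw [List.cons.injEq] at h1
      obtain ⟨h1, rfl⟩ := h1
      refine h (Prod.ext ?_ h1)
      rw [← Multiset.coe_toList p.1, ← Multiset.coe_eq_coe.2 hw]
      rfl

end Leading

/-! ### Straight paths and the closed paths obtained as their commutators -/

section LetterPath

variable (T : ℝ)

/-- The straight path of length `s` in the direction of the `i`-th coordinate. -/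
noncomputable def letterPath (i : ℕ+) (s : ℂ) : PathData T where
  toFun j _ := if j = i then s / T else 0
  measurable _ := measurable_const
  bounded := by
    refine ⟨max 1 ‖s / T‖, by positivity, fun j x _ => ?_⟩
    split_ifs
    · exact (le_max_right 1 _).trans (le_self_pow₀ (le_max_left _ _) j.ne_zero)
    · rw [norm_zero]; positivity

theorem iterInt_letterPath_eq_zero (i : ℕ+) (s : ℂ) {w : List ℕ+} (hw : ∃ j ∈ w, j ≠ i) (x : ℝ) :
    iterInt (w.map (letterPath T i s).toFun) x = 0 := by
  induction w generalizing x with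
  | nil => simp at hw
  | cons k w ih =>
    simp only [List.map_cons, iterInt]
    rw [intervalIntegral.integral_congr (g := fun _ => 0)]
    · simp
    · intro t _
      by_cases hk : k = i
      · obtain ⟨j, hj, hji⟩ := hw
        rcases List.mem_cons.1 hj with rfl | hj
        · exact absurd hk hji
        · simp [ih ⟨j, hj, hji⟩]
      · simp [letterPath, hk]

variable [hT : Fact (0 < T)]

theorem isLetterLike_letterPath (i : ℕ+) (s : ℂ) : IsLetterLike i s (E (letterPath T i s)) := by
  have key : ∀ w : List ℕ+, w ≠ [] → wordSize letterWeight w ≤ i → w ≠ [i] →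
      (E (letterPath T i s)).coeff w = 0 := by
    intro w hw hle hne
    rw [E_coeff]
    refine iterInt_letterPath_eq_zero T i s ?_ T
    by_contra! h
    obtain ⟨k, w, rfl⟩ := List.exists_cons_of_ne_nil hw
    -- A word of weight at most `i` that uses only the letter `i` and is nonempty must be `[i]`.
    obtain rfl : k = i := h k (by simp)
    rw [wordSize_cons] at hle
    have hw0 : w ≠ [] := by rintro rfl; exact hne rfl
    have := wordSize_pos one_le_letterWeight hw0
    change (k : ℕ) + _ ≤ k at hle
    omega
  refine ⟨fun w hw hlt => key w hw hlt.le ?_, ?_, fun w hw hne => key w ?_ hw.le hne⟩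
  · rintro rfl
    simp [wordSize] at hlt
  · have hT0 : (T : ℂ) ≠ 0 := Complex.ofReal_ne_zero.2 hT.out.ne'
    rw [E_coeff, iterInt_singleton]
    simp [letterPath]
    field_simp
  · rintro rfl
    rw [wordSize_nil] at hw
    have := i.pos
    omega

variable {T}

theorem E_mem_closedPathGroup {a : PathData T} (ha : ∀ s : ℕ+, (E a).coeff [s] = 0) :
    E a ∈ closedPathGroup T := ⟨a, (mem_closedPaths_iff a).2 ha, rfl⟩

theorem mem_closedPathGroup_iff {g : SeriesGroup} :
    g ∈ closedPathGroup T ↔ g ∈ pathGroup T ∧ g ∈ filt (fun _ => 1) 2 := by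
  constructor
  · rintro ⟨a, ha, rfl⟩
    refine ⟨⟨a, rfl⟩, fun w hw h => ?_⟩
    rw [wordSize_one] at h
    have hl := List.length_pos_iff.2 hw
    obtain ⟨i, rfl⟩ := List.length_eq_one_iff.1 (show w.length = 1 by omega)
    exact (mem_closedPaths_iff a).1 ha i
  · rintro ⟨⟨a, rfl⟩, h⟩
    exact E_mem_closedPathGroup fun s => h [s] (by simp) (by rw [wordSize_one]; simp)

theorem commutator_mem_closedPathGroup {g h : SeriesGroup} (hg : g ∈ pathGroup T)
    (hh : h ∈ pathGroup T) : ⁅g, h⁆ ∈ closedPathGroup T := by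
  refine mem_closedPathGroup_iff.2 ⟨?_, ?_⟩
  · rw [commutatorElement_def]
    exact mul_mem (mul_mem (mul_mem hg hh) (inv_mem hg)) (inv_mem hh)
  · exact commutator_mem_filt (fun _ => le_rfl) (mem_filt_one (fun _ => le_rfl) g)
      (mem_filt_one (fun _ => le_rfl) h)

/-- The sum is the product of the endpoint values `ã_i(T)`, which vanish for a closed path. -/
theorem permSum_coeff_eq_zero {g : SeriesGroup} (hg : g ∈ closedPathGroup T) {μ : Multiset ℕ+}
    (hμ : μ ≠ 0) : permSum g.coeff μ.toList = 0 := by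
  obtain ⟨a, ha, rfl⟩ := hg
  have h := monomialEval_mul_sum_iterInt a μ.toList [List.nil] (right_mem_Icc.2 hT.out.le)
  rw [insertLetters_singleton_nil, Multiset.coe_toList] at h
  have h1 : (E a).coeff = fun w => iterInt (w.map a.toFun) T := funext (E_coeff a)
  rw [permSum, h1, ← h]
  obtain ⟨i, hi⟩ := Multiset.exists_mem_of_ne_zero hμ
  obtain ⟨μ, rfl⟩ := Multiset.exists_cons_of_mem hi
  rw [monomialEval_cons, integral_letter_of_mem_closedPaths ha]
  simp

end LetterPath

/-! ## Closed paths with prescribed moments of order one -/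

section Realization

/-- The product of the factorials of the multiplicities. -/
def multFact (μ : Multiset ℕ+) : ℕ := ∏ i ∈ μ.toFinset, (μ.count i).factorial

theorem multFact_ne_zero (μ : Multiset ℕ+) : multFact μ ≠ 0 :=
  Finset.prod_ne_zero_iff.2 fun _ _ => Nat.factorial_ne_zero _

theorem multFact_cons (i : ℕ+) (μ : Multiset ℕ+) :
    multFact (i ::ₘ μ) = (μ.count i + 1) * multFact μ := by
  have h1 : multFact μ = ∏ k ∈ (i ::ₘ μ).toFinset, (μ.count k).factorial := by
    refine Finset.prod_subset (fun k hk => ?_) fun k _ hk => ?_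
    · simp only [Multiset.mem_toFinset, Multiset.mem_cons] at hk ⊢
      exact Or.inr hk
    · rw [Multiset.mem_toFinset] at hk
      rw [Multiset.count_eq_zero_of_notMem hk, Nat.factorial_zero]
  have hi : i ∈ (i ::ₘ μ).toFinset := by simp
  rw [h1, multFact, ← Finset.mul_prod_erase _ _ hi, ← Finset.mul_prod_erase _ _ hi,
    Multiset.count_cons_self, Nat.factorial_succ, mul_assoc]
  congr 2
  refine Finset.prod_congr rfl fun k hk => ?_
  rw [Multiset.count_cons_of_ne (Finset.ne_of_mem_erase hk)]

theorem multFact_singleton (i : ℕ+) : multFact {i} = 1 := by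
  simp [multFact]

theorem Form.weight_mk (μ : Multiset ℕ+) (j : ℕ+) : Form.weight (μ, j) = monomialWeight μ + j := rfl

theorem monomialWeight_zero : monomialWeight 0 = 0 := by simp [monomialWeight]

theorem monomialWeight_cons (i : ℕ+) (μ : Multiset ℕ+) :
    monomialWeight (i ::ₘ μ) = i + monomialWeight μ := by simp [monomialWeight]

theorem monomialWeight_erase {i : ℕ+} {μ : Multiset ℕ+} (h : i ∈ μ) :
    i + monomialWeight (μ.erase i) = monomialWeight μ := by
  rw [← monomialWeight_cons, Multiset.cons_erase h]

variable (T : ℝ) [hT : Fact (0 < T)]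

/-- The witness brackets the straight paths of the letters of `ν`, one after the other, onto the
commutator of those for `a` and `b`. Since the inner commutator is closed, each further bracket with
`i` acts on moments of order one only by removing `i` from the monomial, with factor minus its
multiplicity; these multiplicities accumulate to the factorials. -/
theorem exists_formCoeff_bracket (ν : Multiset ℕ+) {a b : ℕ+} (hab : a ≠ b) (s : ℂ) :
    ∃ k ∈ closedPathGroup T, k ∈ filt letterWeight (monomialWeight ν + a + b) ∧
      ∀ p : Form, p.weight = monomialWeight ν + a + b →
        formCoeff k [p] = s * ((if p = (b ::ₘ ν, a) then (multFact (b ::ₘ ν) : ℂ) else 0) -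
          if p = (a ::ₘ ν, b) then (multFact (a ::ₘ ν) : ℂ) else 0) := by
  induction ν using Multiset.induction_on generalizing s with
  | empty =>
    have hu := isLetterLike_letterPath T a s
    have hv := isLetterLike_letterPath T b 1
    refine ⟨⁅E (letterPath T a s), E (letterPath T b 1)⁆,
      commutator_mem_closedPathGroup ⟨_, rfl⟩ ⟨_, rfl⟩, ?_, ?_⟩
    · rw [monomialWeight_zero, zero_add]
      exact commutator_mem_filt one_le_letterWeight hu.mem_filt hv.mem_filt
    · rintro ⟨μ, j⟩ hp
      rw [Form.weight_mk, monomialWeight_zero, zero_add] at hp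
      rw [hu.formCoeff_commutator b.pos hv.mem_filt hp]
      have e1 : ∀ i : ℕ+, (i ::ₘ (0 : Multiset ℕ+)) = {i} := fun i => rfl
      simp only [e1, multFact_singleton, Nat.cast_one, Prod.mk.injEq]
      congr 2
      · by_cases hj : j = a
        · subst hj
          rw [if_pos rfl, hv.permSum_coeff (by omega)]
          simp
        · simp [hj]
      · by_cases ha : a ∈ μ
        · have hw := monomialWeight_erase ha
          rw [hv.formCoeff_singleton (by rw [Form.weight_mk]; omega)]
          by_cases h : μ = {a} ∧ j = b
          · obtain ⟨rfl, rfl⟩ := h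
            simp
          · rw [if_neg h, if_neg, mul_zero]
            rw [Prod.mk.injEq]
            rintro ⟨h1, h2⟩
            refine h ⟨?_, h2⟩
            rw [← Multiset.cons_erase ha, h1]
            rfl
        · rw [Multiset.count_eq_zero_of_notMem ha, if_neg]
          · simp
          · rintro ⟨rfl, -⟩
            simp at ha
  | cons i ν ih =>
    -- The sign compensates the minus sign produced by one more bracket.
    obtain ⟨k, hk, hkf, hkc⟩ := ih (-s)
    have hu := isLetterLike_letterPath T i 1
    have hkp : k ∈ pathGroup T := (mem_closedPathGroup_iff.1 hk).1
    have hwt : monomialWeight (i ::ₘ ν) + a + b = i + (monomialWeight ν + a + b) := by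
      rw [monomialWeight_cons]; ring
    refine ⟨⁅E (letterPath T i 1), k⁆, commutator_mem_closedPathGroup ⟨_, rfl⟩ hkp, ?_, ?_⟩
    · rw [hwt]
      exact commutator_mem_filt one_le_letterWeight hu.mem_filt hkf
    · rintro ⟨μ, j⟩ hp
      rw [Form.weight_mk, hwt] at hp
      rw [hu.formCoeff_commutator (by have := a.pos; omega) hkf hp]
      have hz : (if j = i then permSum k.coeff μ.toList else 0) = 0 := by
        split_ifs with hj
        · refine permSum_coeff_eq_zero hk ?_
          rintro rfl
          subst hj
          have := a.pos
          simp only [monomialWeight, Multiset.map_zero, Multiset.sum_zero] at hp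
          omega
        · rfl
      rw [hz]
      by_cases hi : i ∈ μ
      · obtain ⟨ρ, rfl⟩ := Multiset.exists_cons_of_mem hi
        rw [monomialWeight_cons] at hp
        rw [Multiset.erase_cons_head, hkc _ (by rw [Form.weight_mk]; omega)]
        have e : ∀ c d : ℕ+, ((i ::ₘ ρ, j) : Form) = (c ::ₘ i ::ₘ ν, d) ↔
            ((ρ, j) : Form) = (c ::ₘ ν, d) := by
          intro c d
          rw [Prod.mk.injEq, Prod.mk.injEq, Multiset.cons_swap c i, Multiset.cons_inj_right]
        have e2 : ∀ c d : ℕ+, (if ((ρ, j) : Form) = (c ::ₘ ν, d) then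
              (multFact (c ::ₘ i ::ₘ ν) : ℂ) else 0) =
            ((i ::ₘ ρ).count i : ℂ) *
              if ((ρ, j) : Form) = (c ::ₘ ν, d) then (multFact (c ::ₘ ν) : ℂ) else 0 := by
          intro c d
          split_ifs with h
          · rw [Prod.mk.injEq] at h
            rw [Multiset.cons_swap, multFact_cons, h.1, Multiset.count_cons_self]
            push_cast
            ring
          · rw [mul_zero]
        simp only [e, e2]
        ring
      · have e : ∀ c d : ℕ+, ((μ, j) : Form) ≠ (c ::ₘ i ::ₘ ν, d) := by
          rintro c d h
          rw [Prod.mk.injEq] at h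
          refine hi ?_
          rw [h.1]
          simp
        rw [Multiset.count_eq_zero_of_notMem hi, if_neg (e b a), if_neg (e a b)]
        simp

/-- A chosen letter of a monomial. -/
noncomputable def pivot (β : Multiset ℕ+) : ℕ+ := by
  classical exact if h : ∃ i, i ∈ β then h.choose else 1

theorem pivot_mem {β : Multiset ℕ+} (hβ : β ≠ 0) : pivot β ∈ β := by
  have h : ∃ i, i ∈ β := Multiset.exists_mem_of_ne_zero hβ
  rw [pivot, dif_pos h]
  exact h.choose_spec

/-- The monomial `x_j ∏_{i ∈ μ} x_i` belonging to the form `∏_{i ∈ μ} x_i dx_j`. -/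
def Form.total (p : Form) : Multiset ℕ+ := p.2 ::ₘ p.1

theorem Form.total_ne_zero (p : Form) : p.total ≠ 0 := Multiset.cons_ne_zero

theorem Form.weight_eq_total (p : Form) : p.weight = monomialWeight p.total := by
  rw [Form.total, monomialWeight_cons, Form.weight, add_comm]

theorem Form.erase_total (p : Form) : (p.total.erase p.2, p.2) = p := by
  rw [Form.total, Multiset.erase_cons_head]

theorem Form.total_erase {β : Multiset ℕ+} {j : ℕ+} (h : j ∈ β) :
    Form.total (β.erase j, j) = β := Multiset.cons_erase h

/-- The projections of the forms to a complement of the exact forms: the value of the functional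
belonging to the form `q` at the form `p`. -/
noncomputable def dualForm (q p : Form) : ℂ :=
  if q.2 = pivot q.total then 0 else
    (if p = q then 1 else 0) -
      if p = (q.total.erase (pivot q.total), pivot q.total) then
        (q.total.count q.2 : ℂ) / q.total.count (pivot q.total) else 0

theorem dualForm_eq_zero {q p : Form} (h : p.total ≠ q.total) : dualForm q p = 0 := by
  unfold dualForm
  split_ifs with h1 h2 h3 h3
  · rfl
  · exact absurd (congrArg Form.total h2) h
  · exact absurd (congrArg Form.total h2) h
  · refine absurd ?_ h
    rw [h3, Form.total_erase (pivot_mem q.total_ne_zero)]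
  · simp

theorem dualForm_eq_zero_of_weight {q p : Form} (h : p.weight ≠ q.weight) : dualForm q p = 0 :=
  dualForm_eq_zero fun h1 => h (by rw [Form.weight_eq_total, h1, ← Form.weight_eq_total])

theorem formCoeff_one {W : List Form} (hW : W ≠ []) : formCoeff 1 W = 0 := by
  have h : (1 : SeriesGroup) ∈ filt letterWeight (formsWeight W + 1) := one_mem _
  refine momentSeries_mem_filt h _ (by simpa using hW) ?_
  rw [wordSize_map_enc]
  omega

/-- Moments of order one along closed paths annihilate exact forms, and so does `dualForm q`. A
functional of this shape, supported on `q` and the pivot form, is a multiple of the one given by a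
bracket. -/
theorem exists_formCoeff_eq_dualForm (q : Form) (s : ℂ) :
    ∃ k ∈ closedPathGroup T, k ∈ filt letterWeight q.weight ∧
      ∀ p : Form, p.weight = q.weight → formCoeff k [p] = s * dualForm q p := by
  by_cases hq : q.2 = pivot q.total
  · exact ⟨1, one_mem _, one_mem _, fun p _ => by
      rw [formCoeff_one (by simp), dualForm, if_pos hq, mul_zero]⟩
  · obtain ⟨μ, j⟩ := q
    obtain ⟨r, hr⟩ : ∃ r, pivot (Form.total (μ, j)) = r := ⟨_, rfl⟩
    have hrj : r ≠ j := fun h => hq (h.symm.trans hr.symm)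
    have hmem : r ∈ Form.total (μ, j) := hr ▸ pivot_mem (Form.total_ne_zero _)
    have hrμ : r ∈ μ := (Multiset.mem_cons.1 hmem).resolve_left hrj
    obtain ⟨ν, rfl⟩ := Multiset.exists_cons_of_mem hrμ
    -- The scaling makes the value at `q` itself equal to `s`.
    obtain ⟨k, hk, hkf, hkc⟩ := exists_formCoeff_bracket T ν (a := j) (b := r) hrj.symm
      (s / multFact (r ::ₘ ν))
    have hw : Form.weight (r ::ₘ ν, j) = monomialWeight ν + j + r := by
      rw [Form.weight_mk, monomialWeight_cons]; ring
    refine ⟨k, hk, hw ▸ hkf, fun p hp => ?_⟩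
    have hne : (multFact (r ::ₘ ν) : ℂ) ≠ 0 := Nat.cast_ne_zero.2 (multFact_ne_zero _)
    have htot : Form.total (r ::ₘ ν, j) = r ::ₘ j ::ₘ ν := Multiset.cons_swap _ _ _
    have hcr : ((Form.total (r ::ₘ ν, j)).count r : ℂ) ≠ 0 :=
      Nat.cast_ne_zero.2 (Multiset.count_pos.2 hmem).ne'
    -- Both sides equal `multFact` of the total monomial; this identifies the ratio of factorials
    -- with the ratio of multiplicities in `dualForm`.
    have hcount : ((Form.total (r ::ₘ ν, j)).count j : ℂ) * multFact (r ::ₘ ν) =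
        (Form.total (r ::ₘ ν, j)).count r * multFact (j ::ₘ ν) := by
      have h1 : multFact (Form.total (r ::ₘ ν, j)) =
          (Form.total (r ::ₘ ν, j)).count j * multFact (r ::ₘ ν) := by
        rw [Form.total, multFact_cons, Multiset.count_cons_self]
      have h2 : multFact (Form.total (r ::ₘ ν, j)) =
          (Form.total (r ::ₘ ν, j)).count r * multFact (j ::ₘ ν) := by
        rw [htot, multFact_cons, Multiset.count_cons_self]
      exact_mod_cast h1.symm.trans h2
    have hdiv : ((Form.total (r ::ₘ ν, j)).count j : ℂ) / (Form.total (r ::ₘ ν, j)).count r =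
        multFact (j ::ₘ ν) / multFact (r ::ₘ ν) := by
      rw [div_eq_div_iff hcr hne, hcount, mul_comm]
    rw [hkc p (hp.trans hw), dualForm, if_neg hq, hr, hdiv, htot, Multiset.erase_cons_head]
    split_ifs <;> field_simp <;> ring

/-- A function of forms that kills exact forms is determined by its values in a complement of the
exact forms. -/
theorem sum_mul_dualForm (Q : Finset Form) (φ : Form → ℂ) (p : Form)
    (hQ : ∀ q : Form, q.total = p.total → q ∈ Q)
    (hφ : (p.total.map fun j => φ (p.total.erase j, j)).sum = 0) :
    ∑ q ∈ Q, φ q * dualForm q p = φ p := by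
  set β := p.total with hβ
  have hβ0 : β ≠ 0 := p.total_ne_zero
  have hinj : Function.Injective fun j : ℕ+ => ((β.erase j, j) : Form) :=
    fun i j h => (Prod.ext_iff.1 h).2
  have hsub : β.toFinset.image (fun j : ℕ+ => ((β.erase j, j) : Form)) ⊆ Q := by
    intro q hq
    obtain ⟨j, hj, rfl⟩ := Finset.mem_image.1 hq
    exact hQ _ (Form.total_erase (Multiset.mem_toFinset.1 hj))
  rw [← Finset.sum_subset hsub, Finset.sum_image hinj.injOn]
  · have hr : pivot β ∈ β.toFinset := Multiset.mem_toFinset.2 (pivot_mem hβ0)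
    have hp : (β.erase p.2, p.2) = p := p.erase_total
    have hpm : p.2 ∈ β.toFinset := by simp [hβ, Form.total]
    rw [Finset.sum_multiset_map_count] at hφ
    rw [← Finset.add_sum_erase _ _ hr] at hφ ⊢
    have hcr : (β.count (pivot β) : ℂ) ≠ 0 :=
      Nat.cast_ne_zero.2 (Multiset.count_pos.2 (pivot_mem hβ0)).ne'
    have h0 : dualForm (β.erase (pivot β), pivot β) p = 0 := by
      rw [dualForm, if_pos]
      rw [Form.total_erase (pivot_mem hβ0)]
    have h1 : ∀ j ∈ β.toFinset.erase (pivot β), dualForm (β.erase j, j) p =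
        (if p.2 = j then 1 else 0) - if p.2 = pivot β then
          (β.count j : ℂ) / β.count (pivot β) else 0 := by
      intro j hj
      have hj' := Multiset.mem_toFinset.1 (Finset.mem_of_mem_erase hj)
      have e : ∀ i, p = (β.erase i, i) ↔ p.2 = i := by
        intro i
        constructor
        · intro h; rw [h]
        · rintro rfl; exact hp.symm
      rw [dualForm, Form.total_erase hj', if_neg (Finset.ne_of_mem_erase hj)]
      simp only [e]
    rw [h0, mul_zero, zero_add, Finset.sum_congr rfl fun j hj => (by rw [h1 j hj])]
    -- At the pivot form the relation `hφ` is solved for the value of `φ` there; at any other form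
    -- only the diagonal term survives.
    by_cases hpr : p.2 = pivot β
    · simp only [nsmul_eq_mul] at hφ
      have h2 : ∀ j ∈ β.toFinset.erase (pivot β), φ (β.erase j, j) *
          ((if p.2 = j then 1 else 0) - if p.2 = pivot β then
            (β.count j : ℂ) / β.count (pivot β) else 0) =
          -(1 / (β.count (pivot β) : ℂ)) * (β.count j * φ (β.erase j, j)) := by
        intro j hj
        rw [if_neg (by rw [hpr]; exact (Finset.ne_of_mem_erase hj).symm), if_pos hpr]
        ring
      rw [Finset.sum_congr rfl h2, ← Finset.mul_sum]
      rw [← hpr, hp] at hφ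
      rw [← hpr] at hcr ⊢
      field_simp
      linear_combination -hφ
    · rw [Finset.sum_eq_single_of_mem p.2 (Finset.mem_erase.2 ⟨hpr, hpm⟩)]
      · rw [if_pos rfl, if_neg hpr, hp]
        ring
      · intro j _ hj
        rw [if_neg (Ne.symm hj), if_neg hpr]
        simp
  · intro (q : Form) _ hq
    have : p.total ≠ q.total := by
      intro h
      refine hq (Finset.mem_image.2 ⟨q.2, ?_, ?_⟩)
      · rw [hβ, h]
        simp [Form.total]
      · rw [hβ, h]
        exact q.erase_total
    rw [dualForm_eq_zero this, mul_zero]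

theorem finite_setOf_weight_le (d : ℕ) : {p : Form | p.weight ≤ d}.Finite := by
  let R : Multiset ℕ+ := (Multiset.range d).map Nat.succPNat
  have hR : ∀ i : ℕ+, (i : ℕ) ≤ d → i ∈ R := fun i hi =>
    Multiset.mem_map.2 ⟨i.natPred, Multiset.mem_range.2 (by
      have := i.natPred_add_one; omega), i.succPNat_natPred⟩
  -- Only letters up to `d` can occur, each with multiplicity at most `d`.
  refine ((d • R).powerset.toFinset ×ˢ R.toFinset).finite_toSet.subset fun p hp => ?_
  have hp : monomialWeight p.1 + p.2 ≤ d := hp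
  rw [Finset.mem_coe, Finset.mem_product, Multiset.mem_toFinset, Multiset.mem_toFinset,
    Multiset.mem_powerset]
  refine ⟨Multiset.le_iff_count.2 fun i => ?_, hR _ (by omega)⟩
  have hcard : ∀ μ : Multiset ℕ+, μ.card ≤ monomialWeight μ := fun μ => by
    induction μ using Multiset.induction_on with
    | empty => simp
    | cons i μ ih =>
      rw [Multiset.card_cons, monomialWeight_cons]
      have := i.pos
      omega
  by_cases hi : i ∈ p.1
  · have h1 := monomialWeight_erase hi
    have h2 : 1 ≤ R.count i := Multiset.one_le_count_iff_mem.2 (hR i (by omega))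
    rw [Multiset.count_nsmul]
    have h3 := Multiset.count_le_card i p.1
    have h4 := hcard p.1
    nlinarith
  · rw [Multiset.count_eq_zero_of_notMem hi]
    exact Nat.zero_le _

/-- The finite set of the forms of weight at most `d`. -/
noncomputable def formsOfWeightLE (d : ℕ) : Finset Form := (finite_setOf_weight_le d).toFinset

theorem mem_formsOfWeightLE {d : ℕ} {p : Form} : p ∈ formsOfWeightLE d ↔ p.weight ≤ d :=
  (finite_setOf_weight_le d).mem_toFinset

end Realization

/-! ## Nested commutators and their moments -/

section Words

theorem shSum_map {α β : Type*} (f : α → β) (F : List β → ℂ) (u v : List α) :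
    shSum F (u.map f) (v.map f) = shSum (fun z => F (z.map f)) u v := by
  induction hn : u.length + v.length using Nat.strong_induction_on generalizing F u v with
  | _ n ih =>
    subst hn
    cases u with
    | nil => simp [shSum_nil_left]
    | cons c u =>
      cases v with
      | nil => simp [shSum_nil_right]
      | cons d v =>
        have h1 := ih _ (by simp) (fun z => F (f c :: z)) u (d :: v) rfl
        have h2 := ih _ (by simp) (fun z => F (f d :: z)) (c :: u) v rfl
        simp only [List.map_cons, shSum_cons_cons] at h1 h2 ⊢
        rw [h1, h2]

theorem formsWeight_headI_add {W : List Form} (hW : W ≠ []) :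
    W.headI.weight + formsWeight W.tail = formsWeight W := by
  obtain ⟨p, W, rfl⟩ := List.exists_cons_of_ne_nil hW
  rw [formsWeight_cons]
  rfl

theorem getLastI_concat {α : Type*} [Inhabited α] (l : List α) (x : α) :
    (l ++ [x]).getLastI = x := by
  rw [List.getLastI_eq_getLast?_getD, List.getLast?_concat]
  rfl

theorem formsWeight_getLastI_add {W : List Form} (hW : W ≠ []) :
    W.getLastI.weight + formsWeight W.dropLast = formsWeight W := by
  obtain ⟨W, p, rfl⟩ := List.eq_nil_or_concat W |>.resolve_left hW
  rw [List.concat_eq_append, getLastI_concat, List.dropLast_concat, formsWeight_append, add_comm]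
  simp [formsWeight]

theorem headI_map_enc {W : List Form} (hW : W ≠ []) :
    (W.map Form.enc).headI = W.headI.enc := by
  obtain ⟨p, W, rfl⟩ := List.exists_cons_of_ne_nil hW
  rfl

theorem getLastI_map_enc {W : List Form} (hW : W ≠ []) :
    (W.map Form.enc).getLastI = W.getLastI.enc := by
  obtain ⟨W, p, rfl⟩ := List.eq_nil_or_concat W |>.resolve_left hW
  rw [List.concat_eq_append, List.map_append, List.map_cons, List.map_nil, getLastI_concat,
    getLastI_concat]

theorem length_le_formsWeight (W : List Form) : W.length ≤ formsWeight W := by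
  have h := length_le_wordSize one_le_formSize (W.map Form.enc)
  rwa [wordSize_map_enc, List.length_map] at h

theorem formCoeff_eq_zero {g : SeriesGroup} {d : ℕ} (hg : g ∈ filt letterWeight d) {W : List Form}
    (hW : W ≠ []) (h : formsWeight W < d) : formCoeff g W = 0 :=
  momentSeries_mem_filt hg _ (by simpa using hW) (by rwa [wordSize_map_enc])

/-- The nested bracket of the functionals of a list of forms, as a function of words of forms. -/
noncomputable def nested : List Form → List Form → ℂ
  | [], _ => 0
  | [q], W => dualForm q W.headI
  | q :: r :: L, W =>
    dualForm q W.headI * nested (r :: L) W.tail - nested (r :: L) W.dropLast * dualForm q W.getLastI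

theorem nested_eq_zero {L W : List Form} (hl : W.length = L.length)
    (hw : formsWeight W ≠ formsWeight L) : nested L W = 0 := by
  induction L generalizing W with
  | nil => rfl
  | cons q L ih =>
    have hW : W ≠ [] := by rw [← List.length_pos_iff, hl]; simp
    have h1 := formsWeight_headI_add hW
    have h2 := formsWeight_getLastI_add hW
    rw [formsWeight_cons] at hw
    cases L with
    | nil =>
      obtain ⟨p, rfl⟩ := List.length_eq_one_iff.1 hl
      exact dualForm_eq_zero_of_weight fun h : p.weight = q.weight =>
        hw (by simp [formsWeight, h])
    | cons r L =>
      rw [nested]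
      have e1 : dualForm q W.headI * nested (r :: L) W.tail = 0 := by
        by_cases h : W.headI.weight = q.weight
        · rw [ih (by rw [List.length_tail, hl]; simp) (by omega), mul_zero]
        · rw [dualForm_eq_zero_of_weight h, zero_mul]
      have e2 : nested (r :: L) W.dropLast * dualForm q W.getLastI = 0 := by
        by_cases h : W.getLastI.weight = q.weight
        · rw [ih (by rw [List.length_dropLast, hl]; simp) (by omega), zero_mul]
        · rw [dualForm_eq_zero_of_weight h, mul_zero]
      rw [e1, e2, sub_zero]

/-- All words of length `n` in the forms of a finite set. -/
noncomputable def formWords (Q : Finset Form) : ℕ → List (List Form)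
  | 0 => [List.nil]
  | n + 1 => Q.toList.flatMap fun q => (formWords Q n).map (q :: ·)

theorem length_of_mem_formWords {Q : Finset Form} {n : ℕ} {L : List Form}
    (h : L ∈ formWords Q n) : L.length = n := by
  induction n generalizing L with
  | zero => rw [formWords, List.mem_singleton] at h; subst h; rfl
  | succ n ih =>
    rw [formWords, List.mem_flatMap] at h
    obtain ⟨q, -, h⟩ := h
    obtain ⟨L, hL, rfl⟩ := List.mem_map.1 h
    rw [List.length_cons, ih hL]

theorem sum_formWords_succ (Q : Finset Form) (n : ℕ) (F : List Form → ℂ) :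
    ((formWords Q (n + 1)).map F).sum =
      ((formWords Q n).map fun L => ∑ q ∈ Q, F (q :: L)).sum := by
  have h1 : ∀ X : List Form, ((X.flatMap fun q => (formWords Q n).map (q :: ·)).map F).sum =
      ((formWords Q n).map fun L => (X.map fun q => F (q :: L)).sum).sum := by
    intro X
    induction X with
    | nil => simp
    | cons q X ih =>
      rw [List.flatMap_cons, List.map_append, List.sum_append, ih, List.map_map]
      simp only [List.map_cons, List.sum_cons, List.sum_map_add]
      rfl
  rw [formWords, h1]
  simp only [Finset.sum_map_toList]

/-- `nested` unwinds in the same way as `dyn`. Summing over the outermost form `q` replaces `q` by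
the first or last letter of `W`, by the reproducing property `hφ`. -/
theorem sum_formWords_nested (Q : Finset Form) (n d : ℕ) (φ : List Form → ℂ) (W : List Form)
    (hW : W.length = n + 1) (hd : formsWeight W = d)
    (hφ : ∀ U p V, U.length + V.length = n → formsWeight U + p.weight + formsWeight V = d →
      ∑ q ∈ Q, φ (U ++ q :: V) * dualForm q p = φ (U ++ p :: V)) :
    ((formWords Q (n + 1)).map fun L => φ L * nested L W).sum = dyn n φ W := by
  induction n generalizing d φ W with
  | zero =>
    obtain ⟨p, rfl⟩ := List.length_eq_one_iff.1 hW
    have h := hφ [] p [] rfl (by rw [← hd]; simp [formsWeight])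
    rw [sum_formWords_succ]
    simpa [formWords, nested, dyn] using h
  | succ n ih =>
    have hW0 : W ≠ [] := by rw [← List.length_pos_iff, hW]; simp
    have h1 := formsWeight_headI_add hW0
    have h2 := formsWeight_getLastI_add hW0
    have ih1 := ih (d - W.headI.weight) (fun z => φ (W.headI :: z)) W.tail
      (by rw [List.length_tail, hW]; simp) (by omega) fun U p V hl hw =>
        hφ (W.headI :: U) p V (by rw [List.length_cons]; omega) (by rw [formsWeight_cons]; omega)
    have ih2 := ih (d - W.getLastI.weight) (fun z => φ (W.getLastI :: z)) W.dropLast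
      (by rw [List.length_dropLast, hW]; simp) (by omega) fun U p V hl hw =>
        hφ (W.getLastI :: U) p V (by rw [List.length_cons]; omega)
          (by rw [formsWeight_cons]; omega)
    rw [sum_formWords_succ, dyn, ← ih1, ← ih2]
    have hsub : ∀ (X : List (List Form)) (F G : List Form → ℂ),
        (X.map fun L => F L - G L).sum = (X.map F).sum - (X.map G).sum := by
      intro X F G
      induction X with
      | nil => simp
      | cons L X ih => simp only [List.map_cons, List.sum_cons, ih]; ring
    rw [← hsub]
    refine congrArg List.sum (List.map_congr_left fun L hL => ?_)
    have hLl := length_of_mem_formWords hL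
    obtain ⟨r, L', rfl⟩ := List.exists_cons_of_ne_nil (l := L)
      (by rw [← List.length_pos_iff, hLl]; simp)
    simp only [nested]
    -- The reproducing property is available only at total weight `d`; at other weights the nested
    -- factor is zero.
    have e1 : (∑ q ∈ Q, φ (q :: r :: L') * dualForm q W.headI) * nested (r :: L') W.tail =
        φ (W.headI :: r :: L') * nested (r :: L') W.tail := by
      by_cases h : formsWeight W.tail = formsWeight (r :: L')
      · have h3 := hφ [] W.headI (r :: L') (by simpa using hLl)
          (by rw [← h, ← hd]; simpa [formsWeight] using h1)
        simp only [List.nil_append] at h3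
        rw [h3]
      · rw [nested_eq_zero (by rw [List.length_tail, hW, hLl]; simp) h, mul_zero, mul_zero]
    have e2 : (∑ q ∈ Q, φ (q :: r :: L') * dualForm q W.getLastI) * nested (r :: L') W.dropLast =
        φ (W.getLastI :: r :: L') * nested (r :: L') W.dropLast := by
      by_cases h : formsWeight W.dropLast = formsWeight (r :: L')
      · have h3 := hφ [] W.getLastI (r :: L') (by simpa using hLl)
          (by rw [← h, ← hd]; simpa [formsWeight] using h2)
        simp only [List.nil_append] at h3
        rw [h3]
      · rw [nested_eq_zero (by rw [List.length_dropLast, hW, hLl]; simp) h, mul_zero, mul_zero]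
    rw [← e1, ← e2, Finset.sum_mul, Finset.sum_mul, ← Finset.sum_sub_distrib]
    exact Finset.sum_congr rfl fun q _ => by ring

end Words

/-! ### Approximation of formal closed paths by nested commutators -/

section Commutators

variable (T : ℝ) [hT : Fact (0 < T)]

theorem closedPathGroup_le : closedPathGroup T ≤ formalClosedPathGroup T :=
  (closedPathGroup T).le_topologicalClosure

theorem lowerCentralSeries_closed_le (n : ℕ) :
    (closedPathGroup T).lowerCentralSeries n ≤ (formalClosedPathGroup T).lowerCentralSeries n :=
  Subgroup.lowerCentralSeries_mono n (closedPathGroup_le T)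

theorem lowerCentralSeries_le (K : Subgroup SeriesGroup) (n : ℕ) : K.lowerCentralSeries n ≤ K :=
  K.lowerCentralSeries_antitone (Nat.zero_le n)

/-- On the `n`-th term of the lower central series, all moments of order at most `n` vanish. -/
theorem momentSeries_mem_filt_of_mem_lowerCentralSeries {n : ℕ} {g : SeriesGroup}
    (hg : g ∈ (formalClosedPathGroup T).lowerCentralSeries n) :
    momentSeries g ∈ filt (fun _ => 1) (n + 1) := by
  have key : ∀ n, (⊤ : Subgroup (formalClosedPathGroup T)).lowerCentralSeries n ≤
      (filt (fun _ => 1) (n + 1)).comap (momentHom T) := by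
    intro n
    induction n with
    | zero => exact fun x _ => mem_filt_one (fun _ => le_rfl) _
    | succ n ih =>
      refine Subgroup.commutator_le.2 fun x hx y _ => ?_
      rw [Subgroup.mem_comap, map_commutatorElement]
      exact commutator_mem_filt (fun _ => le_rfl) (ih hx) (mem_filt_one (fun _ => le_rfl) _)
  rw [← Subgroup.top_subtype_lowerCentralSeries] at hg
  obtain ⟨x, hx, rfl⟩ := hg
  exact key n hx

/-- The witness is the nested commutator of the closed paths realizing the functionals `dualForm q`.
At the lowest length, bracketing with one of them uses only its moments of order one, at the first
or last letter. The scalar `s` is put into the innermost path. -/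
theorem exists_formCoeff_eq_nested (L : List Form) (hL : L ≠ []) (s : ℂ) :
    ∃ h ∈ (closedPathGroup T).lowerCentralSeries (L.length - 1),
      h ∈ filt letterWeight (formsWeight L) ∧
      ∀ W : List Form, W.length = L.length → formsWeight W = formsWeight L →
        formCoeff h W = s * nested L W := by
  induction L with
  | nil => exact absurd rfl hL
  | cons q L ih =>
    cases L with
    | nil =>
      obtain ⟨k, hk, hkf, hkc⟩ := exists_formCoeff_eq_dualForm T q s
      refine ⟨k, hk, by simpa [formsWeight] using hkf, fun W hl hw => ?_⟩
      obtain ⟨p, rfl⟩ := List.length_eq_one_iff.1 hl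
      exact hkc p (by simpa [formsWeight] using hw)
    | cons r L =>
      obtain ⟨k, hk, hkf, hkc⟩ := exists_formCoeff_eq_dualForm T q 1
      obtain ⟨h, hh, hhf, hhc⟩ := ih (by simp)
      simp only [List.length_cons, Nat.add_sub_cancel] at hh
      have hh' := lowerCentralSeries_closed_le T _ hh
      refine ⟨⁅k, h⁆, ?_, ?_, fun W hl hw => ?_⟩
      · simp only [List.length_cons, Nat.add_sub_cancel]
        rw [Subgroup.lowerCentralSeries_succ, Subgroup.commutator_comm]
        exact Subgroup.commutator_mem_commutator hk hh
      · rw [formsWeight_cons]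
        exact commutator_mem_filt one_le_letterWeight hkf hhf
      · have hW0 : W ≠ [] := by rw [← List.length_pos_iff, hl]; simp
        have h1 := formsWeight_headI_add hW0
        have h2 := formsWeight_getLastI_add hW0
        rw [formsWeight_cons] at hw
        rw [formCoeff, momentSeries_commutator (closedPathGroup_le T hk)
          (lowerCentralSeries_le _ _ hh'),
          coeff_commutator_length (momentSeries_mem_filt_of_mem_lowerCentralSeries T hh')
            (by omega) (by rw [List.length_map, hl]; simp), headI_map_enc hW0, getLastI_map_enc hW0,
          ← List.map_tail, ← List.map_dropLast, nested]
        change formCoeff k [W.headI] * formCoeff h W.tail -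
          formCoeff h W.dropLast * formCoeff k [W.getLastI] = _
        -- The moments are prescribed only at leading weights. If the weights of `p` and `V` are
        -- split differently from those of the two paths, one piece is too light, and both sides
        -- vanish.
        have key : ∀ (p : Form) (V : List Form), p.weight + formsWeight V = formsWeight W →
            V.length = L.length + 1 → formCoeff k [p] * formCoeff h V =
              s * (dualForm q p * nested (r :: L) V) := by
          intro p V hpV hVl
          rcases lt_trichotomy p.weight q.weight with hlt | heq | hgt
          · rw [formCoeff_eq_zero hkf (by simp) (by simpa [formsWeight] using hlt),
              dualForm_eq_zero_of_weight hlt.ne]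
            ring
          · rw [hkc p heq, hhc V (by simpa using hVl) (by omega)]
            ring
          · rw [formCoeff_eq_zero hhf (by rw [← List.length_pos_iff, hVl]; simp) (by omega),
              dualForm_eq_zero_of_weight hgt.ne']
            ring
        rw [key _ _ h1 (by rw [List.length_tail, hl]; simp), mul_comm (formCoeff h W.dropLast),
          key _ _ h2 (by rw [List.length_dropLast, hl]; simp)]
        ring

/-- Cross terms have weight at least `2 d`, which exceeds `d` because a nonempty word has positive
weight. -/
theorem formCoeff_mul {g h : SeriesGroup} (hg : g ∈ formalClosedPathGroup T)
    (hh : h ∈ formalClosedPathGroup T) {d : ℕ} (hgf : g ∈ filt letterWeight d)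
    (hhf : h ∈ filt letterWeight d) {W : List Form} (hW : W ≠ []) (hd : formsWeight W = d) :
    formCoeff (g * h) W = formCoeff g W + formCoeff h W := by
  have h1 := wordSize_pos one_le_formSize (w := W.map Form.enc) (by simpa using hW)
  rw [formCoeff, momentSeries_mul hg hh]
  refine coeff_mul_of_lt (momentSeries_mem_filt hgf) (momentSeries_mem_filt hhf)
    (by simpa using hW) ?_
  rw [wordSize_map_enc] at *
  omega

/-- The leading moments of a formal closed path are those of an element of the lower central series
of the group of closed paths. -/
theorem exists_formCoeff_eq {g : SeriesGroup} (hg : g ∈ formalClosedPathGroup T) (n d : ℕ)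
    (hgf : g ∈ filt letterWeight d)
    (hlen : ∀ W : List Form, W ≠ [] → formsWeight W = d → W.length ≤ n → formCoeff g W = 0) :
    ∃ h ∈ (closedPathGroup T).lowerCentralSeries n, h ∈ filt letterWeight d ∧
      ∀ W : List Form, formsWeight W = d → W.length = n + 1 → formCoeff h W = formCoeff g W := by
  -- Leading moments are additive, so a linear combination of nested brackets is realized by a
  -- product. Words `L` of weight other than `d` contribute zero and are skipped.
  have hlist : ∀ X : List (List Form), (∀ L ∈ X, L.length = n + 1) →
      ∃ h ∈ (closedPathGroup T).lowerCentralSeries n, h ∈ filt letterWeight d ∧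
        ∀ W : List Form, formsWeight W = d → W.length = n + 1 →
          formCoeff h W = (X.map fun L => formCoeff g L / (n + 1) * nested L W).sum := by
    intro X
    induction X with
    | nil =>
      refine fun _ => ⟨1, one_mem _, one_mem _, fun W _ hl => ?_⟩
      rw [formCoeff_one (by rw [← List.length_pos_iff, hl]; simp)]
      simp
    | cons L X ih =>
      intro hX
      obtain ⟨h, hh, hhf, hhc⟩ := ih fun L' hL' => hX L' (List.mem_cons_of_mem _ hL')
      have hLl := hX L (by simp)
      by_cases hLd : formsWeight L = d
      · obtain ⟨k, hk, hkf, hkc⟩ := exists_formCoeff_eq_nested T L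
          (by rw [← List.length_pos_iff, hLl]; simp) (formCoeff g L / (n + 1))
        rw [hLl, Nat.add_sub_cancel] at hk
        rw [hLd] at hkf
        refine ⟨k * h, mul_mem hk hh, mul_mem hkf hhf, fun W hw hl => ?_⟩
        rw [formCoeff_mul T (closedPathGroup_le T (lowerCentralSeries_le _ _ hk))
          (closedPathGroup_le T (lowerCentralSeries_le _ _ hh)) hkf hhf
          (by rw [← List.length_pos_iff, hl]; simp) hw, hhc W hw hl,
          hkc W (hl.trans hLl.symm) (hw.trans hLd.symm), List.map_cons, List.sum_cons]
      · refine ⟨h, hh, hhf, fun W hw hl => ?_⟩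
        rw [hhc W hw hl, List.map_cons, List.sum_cons,
          nested_eq_zero (hl.trans hLl.symm) (fun h => hLd (h.symm.trans hw)), mul_zero, zero_add]
  obtain ⟨h, hh, hhf, hhc⟩ := hlist (formWords (formsOfWeightLE d) (n + 1))
    fun L => length_of_mem_formWords
  refine ⟨h, hh, hhf, fun W hw hl => ?_⟩
  have h1 := sum_formWords_nested (formsOfWeightLE d) n d (formCoeff g) W hl hw (by
    intro U p V hUV hd
    refine sum_mul_dualForm _ (fun q => formCoeff g (U ++ q :: V)) p (fun q hq => ?_) ?_
    · rw [mem_formsOfWeightLE, Form.weight_eq_total, hq, ← Form.weight_eq_total]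
      omega
    -- Integrating out an exact form leaves words of length `n` and weight `d`, where the moments
    -- vanish by `hlen`.
    · refine sum_formCoeff_exact_eq_zero hg p.total_ne_zero U V fun W hW hWl hWw => ?_
      refine hlen W hW ?_ (by omega)
      rw [hWw, ← hd, Form.weight_eq_total])
  -- A proper shuffle sum is a product of two moments of weight below `d`, both of which are zero.
  have h2 := dyn_eq_of_shuffle n (formCoeff g) W hl (by
    intro u v hu hv hp
    have hsum : formsWeight u + formsWeight v = d := by
      rw [← formsWeight_append, ← hw]
      exact (hp.map _).sum_eq
    have hv1 := (List.length_pos_iff.2 hv).trans_le (length_le_formsWeight v)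
    have h3 := momentSeries_shuffle hg (u.map Form.enc) (v.map Form.enc)
    rw [shSum_map] at h3
    refine h3.symm.trans ?_
    have h4 : (momentSeries g).coeff (u.map Form.enc) = 0 :=
      formCoeff_eq_zero hgf hu (by omega)
    rw [h4, zero_mul])
  have hn : (n + 1 : ℂ) ≠ 0 := Nat.cast_add_one_ne_zero n
  rw [hhc W hw hl]
  have h5 : ∀ L, formCoeff g L / (n + 1) * nested L W =
      (1 / (n + 1 : ℂ)) * (formCoeff g L * nested L W) := fun L => by ring
  simp only [h5, List.sum_map_mul_left]
  rw [h1, h2]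
  field_simp

/-- At fixed weight the moments are removed in order of increasing length. Since length is at most
weight, this ends after finitely many steps, and then no coefficient of weight `d` is left. -/
theorem exists_mul_mem_filt_succ {g : SeriesGroup} (hg : g ∈ formalClosedPathGroup T) (n d : ℕ)
    (hgf : g ∈ filt letterWeight d) (hgm : momentSeries g ∈ filt (fun _ => 1) (n + 1)) :
    ∃ h ∈ (closedPathGroup T).lowerCentralSeries n, h⁻¹ * g ∈ filt letterWeight (d + 1) := by
  have key : ∀ m, n ≤ m → ∃ h ∈ (closedPathGroup T).lowerCentralSeries n,
      h ∈ filt letterWeight d ∧ ∀ W : List Form, W ≠ [] → formsWeight W = d → W.length ≤ m →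
        formCoeff (h⁻¹ * g) W = 0 := by
    intro m hm
    induction m, hm using Nat.le_induction with
    | base =>
      refine ⟨1, one_mem _, one_mem _, fun W hW _ hl => ?_⟩
      rw [inv_one, one_mul]
      exact hgm _ (by simpa using hW) (by rw [wordSize_one, List.length_map]; omega)
    | succ m hm ih =>
      obtain ⟨h, hh, hhf, hhc⟩ := ih
      have hg' : h⁻¹ * g ∈ formalClosedPathGroup T :=
        mul_mem (inv_mem (closedPathGroup_le T (lowerCentralSeries_le _ _ hh))) hg
      have hgf' : h⁻¹ * g ∈ filt letterWeight d := mul_mem (inv_mem hhf) hgf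
      obtain ⟨k, hk, hkf, hkc⟩ := exists_formCoeff_eq T hg' m d hgf' hhc
      have hkm := momentSeries_mem_filt_of_mem_lowerCentralSeries T
        (lowerCentralSeries_closed_le T _ hk)
      have hkK := closedPathGroup_le T (lowerCentralSeries_le _ _ hk)
      refine ⟨h * k, mul_mem hh ((closedPathGroup T).lowerCentralSeries_antitone hm hk),
        mul_mem hhf hkf, fun W hW hw hl => ?_⟩
      -- By additivity the new moments are the old ones minus those of `k`, and `k` has no moments
      -- of length at most `m`, so earlier progress is kept.
      have e : h⁻¹ * g = k * ((h * k)⁻¹ * g) := by group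
      have h1 := formCoeff_mul T hkK (mul_mem (inv_mem
        (mul_mem (closedPathGroup_le T (lowerCentralSeries_le _ _ hh)) hkK)) hg) hkf
        (mul_mem (inv_mem (mul_mem hhf hkf)) hgf) hW hw
      rw [← e] at h1
      rcases Nat.lt_or_ge m W.length with hlt | hle
      · rw [hkc W hw (by omega)] at h1
        linear_combination -h1
      · have h2 : formCoeff k W = 0 :=
          hkm _ (by simpa using hW) (by rw [wordSize_one, List.length_map]; omega)
        rw [hhc W hW hw hle, h2] at h1
        linear_combination -h1
  -- Length `d` suffices for words of weight `d`; the maximum only meets the constraint `n ≤ m`.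
  obtain ⟨h, hh, hhf, hhc⟩ := key (max n d) (le_max_left _ _)
  refine ⟨h, hh, fun w hw hd => ?_⟩
  rcases Nat.lt_or_ge (wordSize letterWeight w) d with hlt | hge
  · exact mul_mem (inv_mem hhf) hgf w hw hlt
  · have hwd : formsWeight (w.map Form.single) = d := by rw [formsWeight_single]; omega
    rw [coeff_eq_formCoeff]
    refine hhc _ (by simpa using hw) hwd ?_
    exact (length_le_formsWeight _).trans (hwd.le.trans (le_max_right _ _))

theorem exists_mul_mem_filt {g : SeriesGroup} (hg : g ∈ formalClosedPathGroup T) (n d : ℕ)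
    (hgm : momentSeries g ∈ filt (fun _ => 1) (n + 1)) :
    ∃ h ∈ (closedPathGroup T).lowerCentralSeries n, h⁻¹ * g ∈ filt letterWeight d := by
  induction d with
  | zero => exact ⟨1, one_mem _, fun _ _ h => absurd h (Nat.not_lt_zero _)⟩
  | succ d ih =>
    obtain ⟨h, hh, hhf⟩ := ih
    have hh' := lowerCentralSeries_closed_le T _ hh
    have hhK := lowerCentralSeries_le _ _ hh'
    have hm : momentSeries (h⁻¹ * g) ∈ filt (fun _ => 1) (n + 1) := by
      rw [momentSeries_mul (inv_mem hhK) hg]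
      exact mul_mem (momentSeries_mem_filt_of_mem_lowerCentralSeries T (inv_mem hh')) hgm
    obtain ⟨k, hk, hkf⟩ := exists_mul_mem_filt_succ T (mul_mem (inv_mem hhK) hg) n d hhf hm
    refine ⟨h * k, mul_mem hh hk, ?_⟩
    rwa [mul_inv_rev, mul_assoc]

/-- The elements of the closure of the lower central series are those without moments of low
order. -/
theorem mem_closure_lowerCentralSeries {g : SeriesGroup} (hg : g ∈ formalClosedPathGroup T) {n : ℕ}
    (hgm : momentSeries g ∈ filt (fun _ => 1) (n + 1)) :
    g ∈ closure ((closedPathGroup T).lowerCentralSeries n : Set SeriesGroup) := by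
  choose h hh hhf using fun d => exists_mul_mem_filt T hg n d hgm
  -- The coefficient at a word of `h d` equals that of `g` as soon as `d` exceeds the weight of the
  -- word.
  refine mem_closure_of_tendsto (f := h) (b := Filter.atTop) ?_ (Filter.Eventually.of_forall hh)
  have hind : Topology.IsInducing SeriesGroup.coeff := ⟨rfl⟩
  rw [hind.tendsto_nhds_iff, tendsto_pi_nhds]
  intro w
  refine tendsto_const_nhds.congr' ?_
  filter_upwards [Filter.eventually_gt_atTop (wordSize letterWeight w)] with d hd
  rcases eq_or_ne w [] with rfl | hw
  · rw [g.coeff_nil, Function.comp_apply, (h d).coeff_nil]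
  · have h1 : g = h d * ((h d)⁻¹ * g) := by group
    have h0 : h d ∈ filt letterWeight 0 := fun _ _ h => absurd h (Nat.not_lt_zero _)
    conv_lhs => rw [h1]
    rw [coeff_mul_of_lt h0 (hhf d) hw (by omega), hhf d w hw hd, add_zero]
    rfl

theorem momentSeries_mem_filt_of_mem_closure {g : SeriesGroup} {n : ℕ}
    (hg : g ∈ closure ((formalClosedPathGroup T).lowerCentralSeries n : Set SeriesGroup)) :
    momentSeries g ∈ filt (fun _ => 1) (n + 1) := by
  intro W hW hl
  refine closure_minimal (t := {g | (momentSeries g).coeff W = 0}) (fun x hx => ?_) ?_ hg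
  · exact momentSeries_mem_filt_of_mem_lowerCentralSeries T hx W hW hl
  · exact isClosed_eq ((SeriesGroup.continuous_coeff W).comp continuous_momentSeries)
      continuous_const

end Commutators

/-! ## Moments on the group of formal paths -/

section Moments

/-- The form belonging to the index of an element of `𝒫(X)`. -/
def MomentFactor.toForm (p : MomentFactor) : Form :=
  ((p.1.map fun q => Multiset.replicate q.2 q.1).sum, p.2)

theorem MomentFactor.eval_toForm {T : ℝ} (p : MomentFactor) (a : PathData T) (x : ℝ) :
    p.toForm.eval a x = p.eval a x := by
  obtain ⟨l, j⟩ := p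
  simp only [MomentFactor.toForm, Form.eval, MomentFactor.eval]
  congr 1
  induction l with
  | nil => simp [monomialEval_zero]
  | cons q l ih =>
    rw [List.map_cons, List.sum_cons, monomialEval_add, ih, List.map_cons, List.prod_cons]
    simp [monomialEval]

/-- An index of a form as an element of `𝒫(X)`. -/
noncomputable def Form.toMomentFactor (p : Form) : MomentFactor :=
  (p.1.toList.map fun i => (i, 1), p.2)

theorem Form.toForm_toMomentFactor (p : Form) : p.toMomentFactor.toForm = p := by
  obtain ⟨μ, j⟩ := p
  simp only [Form.toMomentFactor, MomentFactor.toForm, Prod.mk.injEq, and_true, List.map_map]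
  conv_rhs => rw [← Multiset.coe_toList μ]
  generalize μ.toList = l
  induction l with
  | nil => rfl
  | cons i l ih =>
    rw [List.map_cons, List.sum_cons, ih, ← Multiset.cons_coe]
    simp

variable {T : ℝ} [hT : Fact (0 < T)]

theorem moment_eq_formCoeff (P : List MomentFactor) (a : PathData T) :
    moment P a = formCoeff (E a) (P.reverse.map MomentFactor.toForm) := by
  rw [formCoeff_E, moment]
  generalize P.reverse = L
  have key : ∀ x ∈ Icc 0 T, iterInt (L.map fun p => p.eval a) x =
      formInt a (L.map MomentFactor.toForm) x := by
    induction L with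
    | nil => exact fun _ _ => rfl
    | cons p L ih =>
      intro x hx
      rw [List.map_cons, List.map_cons, formInt_cons a _ _ hx]
      refine intervalIntegral.integral_congr fun s hs => ?_
      rw [uIcc_of_le hx.1] at hs
      simp only [ih s ⟨hs.1, hs.2.trans hx.2⟩, MomentFactor.eval_toForm]
  exact key T (right_mem_Icc.2 hT.out.le)

/-- Density makes the continuous extension of a moment unique, so every moment on formal paths is
some `formCoeff`. -/
theorem dense_range_E : Dense (range fun a : PathData T =>
    (⟨E a, E_mem_formalPathGroup T a⟩ : formalPathGroup T)) := by
  intro x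
  rw [closure_subtype]
  have h : ((↑) '' range fun a : PathData T =>
      (⟨E a, E_mem_formalPathGroup T a⟩ : formalPathGroup T) : Set SeriesGroup) =
      (pathGroup T : Set SeriesGroup) := by
    rw [← range_comp]
    rfl
  rw [h]
  exact x.2

theorem IsMoment.exists_eq_formCoeff {k : ℕ} {m : formalPathGroup T → ℂ} (hm : IsMoment k m) :
    ∃ W : List Form, W.length = k ∧ ∀ x, m x = formCoeff x W := by
  obtain ⟨hc, P, hP, h⟩ := hm
  refine ⟨P.reverse.map MomentFactor.toForm, by simpa using hP, fun x => ?_⟩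
  refine congrFun (hc.ext_on dense_range_E
    ((continuous_formCoeff (P.reverse.map MomentFactor.toForm)).comp continuous_subtype_val) ?_) x
  rintro _ ⟨a, rfl⟩
  exact (h a).trans (moment_eq_formCoeff P a)

theorem isMoment_formCoeff (W : List Form) :
    IsMoment W.length fun x : formalPathGroup T => formCoeff x W := by
  refine ⟨(continuous_formCoeff W).comp continuous_subtype_val,
    W.reverse.map Form.toMomentFactor, by simp, fun a => ?_⟩
  rw [moment_eq_formCoeff, ← List.map_reverse, List.reverse_reverse, List.map_map]
  have : MomentFactor.toForm ∘ Form.toMomentFactor = id := funext Form.toForm_toMomentFactor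
  rw [this, List.map_id]

theorem forall_isMoment_iff (x : formalPathGroup T) (n : ℕ) :
    (∀ k : ℕ, 1 ≤ k → k ≤ n → ∀ m : formalPathGroup T → ℂ, IsMoment k m → m x = 0) ↔
      momentSeries (x : SeriesGroup) ∈ filt (fun _ => 1) (n + 1) := by
  constructor
  · intro h W hW hl
    rw [wordSize_one] at hl
    refine momentSeries_coeff_eq_zero_of_formCoeff fun V hV => ?_
    subst hV
    rw [List.length_map] at hl
    exact h V.length (List.length_pos_iff.2 (by simpa using hW)) (by omega) _ (isMoment_formCoeff V)
  · intro h k hk hkn m hm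
    obtain ⟨W, hl, hmW⟩ := hm.exists_eq_formCoeff
    rw [hmW]
    refine h _ ?_ (by rw [wordSize_one, List.length_map]; omega)
    rw [← List.length_pos_iff, List.length_map]
    omega

/-- Closure in a subgroup is the trace of closure in `G`, so both series can be compared inside one
space. -/
theorem mem_topLowerCentralSeries_iff (K : Subgroup SeriesGroup) (n : ℕ) (x : K) :
    x ∈ topLowerCentralSeries K n ↔
      (x : SeriesGroup) ∈ closure (K.lowerCentralSeries n : Set SeriesGroup) := by
  rw [topLowerCentralSeries, closure_subtype, ← Subgroup.top_subtype_lowerCentralSeries K n,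
    Subgroup.coe_map]
  rfl

end Moments

end FormalPaths

/-! ### Characterization of the topological lower central series by moments -/

theorem theorem2p19 (T : ℝ) [Fact (0 < T)] (n : ℕ) (hn : 1 ≤ n) :
    (∀ g : FormalPaths.formalClosedPathGroup T,
      g ∈ FormalPaths.topLowerCentralSeries (FormalPaths.formalClosedPathGroup T) n ↔
        ∀ k : ℕ, 1 ≤ k → k ≤ n →
          ∀ m : FormalPaths.formalPathGroup T → ℂ, FormalPaths.IsMoment k m →
            m (Subgroup.inclusion (FormalPaths.formalClosedPathGroup_le T) g) = 0) ∧
    ((↑) '' FormalPaths.topLowerCentralSeries (FormalPaths.closedPathGroup T) n :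
        Set FormalPaths.SeriesGroup) =
      ((↑) '' FormalPaths.topLowerCentralSeries (FormalPaths.formalClosedPathGroup T) n) ∩
        (FormalPaths.closedPathGroup T : Set FormalPaths.SeriesGroup) := by
  have hmono := closure_mono (SetLike.coe_subset_coe.2
    (FormalPaths.lowerCentralSeries_closed_le T n))
  refine ⟨fun g => ?_, ?_⟩
  · rw [FormalPaths.forall_isMoment_iff, FormalPaths.mem_topLowerCentralSeries_iff]
    exact ⟨FormalPaths.momentSeries_mem_filt_of_mem_closure T,
      fun h => hmono (FormalPaths.mem_closure_lowerCentralSeries T g.2 h)⟩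
  · ext x
    constructor
    · rintro ⟨y, hy, rfl⟩
      rw [FormalPaths.mem_topLowerCentralSeries_iff] at hy
      exact ⟨⟨⟨y, FormalPaths.closedPathGroup_le T y.2⟩,
        (FormalPaths.mem_topLowerCentralSeries_iff _ n _).2 (hmono hy), rfl⟩, y.2⟩
    -- Vanishing of moments places the element in the closure of the lower central series of genuine
    -- closed paths, even though only formal ones were assumed to approximate it.
    · rintro ⟨⟨y, hy, rfl⟩, hx⟩
      rw [FormalPaths.mem_topLowerCentralSeries_iff] at hy
      exact ⟨⟨y, hx⟩, (FormalPaths.mem_topLowerCentralSeries_iff _ n _).2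
        (FormalPaths.mem_closure_lowerCentralSeries T y.2
          (FormalPaths.momentSeries_mem_filt_of_mem_closure T hy)), rfl⟩
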